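/- Let $G$ be a finite simple connected graph on at least $3$ vertices, let $\lambda_1(G)$ be the largest eigenvalue of its adjacency matrix, and for an integer $\gamma\ge 1$ let $\chi_\gamma(G)$ be the chromatic number of the graph $G^\gamma$ on the vertex set of $G$ in which two distinct vertices are adjacent if and only if their distance in $G$ is at most $\gamma$. A Moore graph with degree $\Delta$ and diameter $k$ is a connected $\Delta$-regular graph of diameter $k$ and girth $2k+1$ with exactly $1+\Delta\sum_{i=0}^{k-1}(\Delta-1)^i$ vertices. Then $$\chi_2(G)\le\lambda_1(G)^2+1,$$ with equality if and only if $G$ is a star or a Moore graph with diameter $2$ and girth $5$. Moreover, for every integer $\gamma\ge 3$, $$\chi_\gamma(G)<\lambda_1(G)^\gamma+1.$$ -/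

import Mathlib

namespace SimpleGraph

/-- The `γ`-th power of `G`: two distinct vertices are adjacent iff their distance in `G` is at
most `γ`. The extended distance is used, so vertices in different components are not adjacent. -/
def distPower {V : Type*} (G : SimpleGraph V) (γ : ℕ) : SimpleGraph V where
  Adj u v := u ≠ v ∧ G.edist u v ≤ (γ : ℕ∞)
  symm := ⟨fun _ _ h => ⟨h.1.symm, by rw [SimpleGraph.edist_comm]; exact h.2⟩⟩
  loopless := ⟨fun _ h => h.1 rfl⟩

/-- The `γ`-distance chromatic number of a graph on a finite vertex set: the chromatic number of
its `γ`-th power. On a finite vertex set the chromatic number is finite, so `ENat.toNat` loses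
nothing; see `natCast_distChromaticNumber`. -/
noncomputable def distChromaticNumber {V : Type*} [Finite V] (G : SimpleGraph V) (γ : ℕ) : ℕ :=
  (G.distPower γ).chromaticNumber.toNat

theorem natCast_distChromaticNumber {V : Type*} [Finite V] (G : SimpleGraph V) (γ : ℕ) :
    (G.distChromaticNumber γ : ℕ∞) = (G.distPower γ).chromaticNumber := by
  have := Fintype.ofFinite V
  exact ENat.natCast_toNat
    (chromaticNumber_ne_top_iff_exists.mpr ⟨_, (G.distPower γ).colorable_of_fintype⟩)

/-- The largest eigenvalue of the real adjacency matrix of `G`. -/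
noncomputable def lambdaOne {V : Type*} [Fintype V] [DecidableEq V] (G : SimpleGraph V)
    [DecidableRel G.Adj] : ℝ :=
  sSup (spectrum ℝ (G.adjMatrix ℝ))

/-- On a nonempty vertex set the supremum in `lambdaOne` is a maximum. -/
theorem isGreatest_lambdaOne {V : Type*} [Fintype V] [DecidableEq V] [Nonempty V]
    (G : SimpleGraph V) [DecidableRel G.Adj] :
    IsGreatest (spectrum ℝ (G.adjMatrix ℝ)) G.lambdaOne := by
  have hA : (G.adjMatrix ℝ).IsHermitian := by
    rw [Matrix.IsHermitian, Matrix.conjTranspose_eq_transpose_of_trivial]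
    exact G.isSymm_adjMatrix
  have h := hA.spectrum_real_eq_range_eigenvalues
  have hne : (spectrum ℝ (G.adjMatrix ℝ)).Nonempty := h ▸ Set.range_nonempty _
  have hfin : (spectrum ℝ (G.adjMatrix ℝ)).Finite := h ▸ Set.finite_range _
  exact ⟨hne.csSup_mem hfin, fun _ hx => le_csSup hfin.bddAbove hx⟩

/-- `G` is a star: some vertex is adjacent to all the others, and there are no further edges. -/
def IsStar {V : Type*} (G : SimpleGraph V) : Prop :=
  ∃ r : V, G = starGraph r

/-- `G` is a Moore graph with degree `d` and diameter `k`: it is connected, `d`-regular, of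
diameter `k` and girth `2 * k + 1`, and its order is the Moore bound
`1 + d * (1 + (d - 1) + ⋯ + (d - 1) ^ (k - 1))`. -/
structure IsMooreGraph {V : Type*} [Fintype V] (G : SimpleGraph V) [DecidableRel G.Adj]
    (d k : ℕ) : Prop where
  connected : G.Connected
  regular : G.IsRegularOfDegree d
  card_eq : Fintype.card V = 1 + d * ∑ i ∈ Finset.range k, (d - 1) ^ i
  ediam_eq : G.ediam = (k : ℕ∞)
  egirth_eq : G.egirth = 2 * (k : ℕ∞) + 1

end SimpleGraph

/-! Let `y` be the Perron vector. If `m + 1` is the chromatic number of the `γ`-th power, the power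
is not `m`-colorable, so greedy coloring yields a nonempty set `U` inside which every vertex has at
least `m` power-neighbors. Take `v ∈ U` minimizing `y` on `U`, scale so that `y v = 1`, and let `f`
be the indicator of `U`. Then `0 ≤ f ≤ 1`, `f ≤ y`, and the ball of radius `γ` at `v` has `f`-weight
at least `m + 1`. It remains to bound this weight by `lam ^ γ + 1`, i.e. to show that the slack is
nonnegative.

Comparing the ball at `v` with those at its neighbors gives a two-step recursion for the slack,
which becomes a recursion for its increments along edges. Two lower bounds on the increments (one
with `y`, one without) combine through AM-GM to `-lam ^ k / 4` for `k ≥ 1`. Hence wherever `y ≥ 1`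
the slack strictly increases from radius `k + 1` to `k + 3`. This gives the bound for every radius,
and strictness from radius 3 on.

If equality holds for `γ = 2`, then `m = lam ^ 2`, and counting walks of length two at a minimizing
vertex is tight: there are no triangles or quadrilaterals through it, and `y` has the same value at
distance two. Either two minimizing vertices are adjacent, so `y` is constant and `G` is regular, or
`G` is bipartite with the minimizing vertices as one side. In each case a Brooks-type argument (give
two vertices one color, then finish greedily at a common square-neighbor) colors the square with `m`
colors unless `G` is a Moore graph, respectively a star. -/

namespace SimpleGraph

/-! ### Perron eigenvectors of connected graphs -/

section PerronVector

variable {V : Type*} [Fintype V] [DecidableEq V] (G : SimpleGraph V) [DecidableRel G.Adj]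

omit [Fintype V] [DecidableEq V] in
theorem isHermitian_adjMatrix_real : (G.adjMatrix ℝ).IsHermitian := by
  rw [Matrix.IsHermitian, Matrix.conjTranspose_eq_transpose_of_trivial]
  exact G.isSymm_adjMatrix

open Matrix in
theorem posSemidef_lambdaOne_sub_adjMatrix [Nonempty V] :
    (algebraMap ℝ (Matrix V V ℝ) G.lambdaOne - G.adjMatrix ℝ).PosSemidef := by
  have hH : (algebraMap ℝ (Matrix V V ℝ) G.lambdaOne - G.adjMatrix ℝ).IsHermitian := by
    refine IsHermitian.sub ?_ G.isHermitian_adjMatrix_real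
    rw [Matrix.algebraMap_eq_diagonal, Matrix.IsHermitian, Matrix.diagonal_conjTranspose]
    rfl
  rw [Matrix.posSemidef_iff_isHermitian_and_spectrum_nonneg]
  refine ⟨hH, ?_⟩
  rw [← spectrum.singleton_sub_eq]
  rintro _ ⟨a, rfl, b, hb, rfl⟩
  exact sub_nonneg.mpr (G.isGreatest_lambdaOne.2 hb)

open Matrix in
-- Taking absolute values entrywise in an eigenvector does not decrease the quadratic form of the
-- adjacency matrix, so the new vector annihilates the form of the positive semidefinite matrix
-- `lambdaOne - A` and lies in its kernel.
theorem exists_nonneg_eigenvector_lambdaOne [Nonempty V] :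
    ∃ y : V → ℝ, y ≠ 0 ∧ (∀ v, 0 ≤ y v) ∧
      ∀ v, ∑ w ∈ G.neighborFinset v, y w = G.lambdaOne * y v := by
  have hmem := G.isGreatest_lambdaOne.1
  rw [← Matrix.spectrum_toLin', ← Module.End.hasEigenvalue_iff_mem_spectrum] at hmem
  obtain ⟨x, hx⟩ := hmem.exists_hasEigenvector
  have hxA : G.adjMatrix ℝ *ᵥ x = G.lambdaOne • x := by
    simpa [Matrix.toLin'_apply] using hx.apply_eq_smul
  have hx0 := hx.2
  set y : V → ℝ := fun v => |x v| with hy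
  have hpsd := G.posSemidef_lambdaOne_sub_adjMatrix
  have key : ∀ z : V → ℝ,
      z ⬝ᵥ ((algebraMap ℝ (Matrix V V ℝ) G.lambdaOne - G.adjMatrix ℝ) *ᵥ z) =
        G.lambdaOne * (z ⬝ᵥ z) - z ⬝ᵥ (G.adjMatrix ℝ *ᵥ z) := by
    intro z
    rw [Matrix.sub_mulVec, dotProduct_sub, Algebra.algebraMap_eq_smul_one, Matrix.smul_mulVec,
      Matrix.one_mulVec, dotProduct_smul, smul_eq_mul]
  have hyy : y ⬝ᵥ y = x ⬝ᵥ x := by simp [dotProduct, hy]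
  have hle : x ⬝ᵥ (G.adjMatrix ℝ *ᵥ x) ≤ y ⬝ᵥ (G.adjMatrix ℝ *ᵥ y) := by
    rw [dotProduct_mulVec_adjMatrix, dotProduct_mulVec_adjMatrix]
    refine Finset.sum_le_sum fun i _ => Finset.sum_le_sum fun j _ => ?_
    split_ifs
    · simpa [hy, abs_mul] using le_abs_self (x i * x j)
    · exact le_rfl
  have hxx : x ⬝ᵥ (G.adjMatrix ℝ *ᵥ x) = G.lambdaOne * (x ⬝ᵥ x) := by
    rw [hxA, dotProduct_smul, smul_eq_mul]
  have hzero : y ⬝ᵥ ((algebraMap ℝ (Matrix V V ℝ) G.lambdaOne - G.adjMatrix ℝ) *ᵥ y) = 0 := by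
    refine le_antisymm ?_ (by simpa using hpsd.dotProduct_mulVec_nonneg y)
    rw [key, hyy]
    linarith
  have hAy := (hpsd.dotProduct_mulVec_zero_iff y).1 (by simpa using hzero)
  refine ⟨y, ?_, fun v => abs_nonneg _, fun v => ?_⟩
  · intro h
    exact hx0 (funext fun v => by simpa [hy] using congrFun h v)
  · have := congrFun hAy v
    rw [Matrix.sub_mulVec, Algebra.algebraMap_eq_smul_one, Matrix.smul_mulVec,
      Matrix.one_mulVec] at this
    simp only [Pi.sub_apply, Pi.smul_apply, smul_eq_mul, adjMatrix_mulVec_apply,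
      Pi.zero_apply] at this
    linarith

/-- `y` is a positive eigenvector of the adjacency matrix of `G` with eigenvalue `lam`. -/
structure IsPerronVector (lam : ℝ) (y : V → ℝ) : Prop where
  pos : ∀ v, 0 < y v
  sum_eq : ∀ v, ∑ w ∈ G.neighborFinset v, y w = lam * y v

variable {G}

omit [Fintype V] [DecidableEq V] [DecidableRel G.Adj] in
theorem Connected.forall_of_adj_closed (hconn : G.Connected) {p : V → Prop}
    (hp : ∀ v w, p v → G.Adj v w → p w) {v : V} (hv : p v) (w : V) : p w := by
  obtain ⟨q⟩ := hconn.preconnected v w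
  induction q with
  | nil => exact hv
  | cons h _ ih => exact ih (hp _ _ hv h)

/-- A zero entry of a nonnegative eigenvector forces zeros at all neighbors, hence everywhere. -/
theorem Connected.exists_isPerronVector (hconn : G.Connected) :
    ∃ y : V → ℝ, G.IsPerronVector G.lambdaOne y := by
  have := hconn.nonempty
  obtain ⟨y, hy0, hnn, hsum⟩ := G.exists_nonneg_eigenvector_lambdaOne
  refine ⟨y, ⟨fun v => (hnn v).lt_of_ne' fun hv => hy0 ?_, hsum⟩⟩
  refine funext fun w => hconn.forall_of_adj_closed (p := fun v => y v = 0) ?_ hv w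
  intro a b ha hab
  have h := hsum a
  rw [ha, mul_zero, Finset.sum_eq_zero_iff_of_nonneg fun i _ => hnn i] at h
  exact h b (by simpa using hab)

theorem Connected.exists_two_neighbors (hconn : G.Connected) (hcard : 3 ≤ Fintype.card V) :
    ∃ v a b, a ≠ b ∧ G.Adj v a ∧ G.Adj v b := by
  by_contra! h
  obtain ⟨v⟩ := hconn.nonempty
  have : Nontrivial V := Fintype.one_lt_card_iff_nontrivial.1 (by omega)
  obtain ⟨a, hva⟩ := hconn.preconnected.exists_adj_of_nontrivial v
  have hall := hconn.forall_of_adj_closed (p := fun x => x = v ∨ x = a) (by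
    rintro x w (rfl | rfl) hxw
    · by_contra! hw
      exact h _ _ _ hw.2.symm hva hxw
    · by_contra! hw
      exact h _ _ _ hw.1.symm hva.symm hxw) (Or.inl rfl)
  have : (Finset.univ : Finset V) ⊆ {v, a} := fun x _ => by simpa using hall x
  have := (Finset.card_le_card this).trans Finset.card_le_two
  rw [Finset.card_univ] at this
  omega

namespace IsPerronVector

variable {lam : ℝ} {y : V → ℝ} (hy : G.IsPerronVector lam y)
include hy

omit [DecidableEq V] in
theorem le_of_adj {v w : V} (h : G.Adj v w) : y w ≤ lam * y v := by
  rw [← hy.sum_eq]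
  exact Finset.single_le_sum (f := y) (fun i _ => (hy.pos i).le) (by simpa using h)

theorem two_le_sq (hconn : G.Connected) (hcard : 3 ≤ Fintype.card V) : 2 ≤ lam ^ 2 := by
  obtain ⟨v, a, b, hab, hva, hvb⟩ := hconn.exists_two_neighbors hcard
  have h1 := hy.le_of_adj hva.symm
  have h2 := hy.le_of_adj hvb.symm
  have h3 : y a + y b ≤ lam * y v := by
    rw [← hy.sum_eq, ← Finset.sum_pair hab]
    refine Finset.sum_le_sum_of_subset_of_nonneg ?_ fun i _ _ => (hy.pos i).le
    intro x; simp only [Finset.mem_insert, Finset.mem_singleton, mem_neighborFinset]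
    rintro (rfl | rfl) <;> assumption
  have hlam : 0 < lam := by
    have := hy.pos a; have := hy.pos b
    exact pos_of_mul_pos_left (by linarith) (hy.pos v).le
  have := hy.pos v
  nlinarith

theorem pos_of_adj {v w : V} (h : G.Adj v w) : 0 < lam :=
  pos_of_mul_pos_left ((hy.pos w).trans_le (hy.le_of_adj h)) (hy.pos v).le

theorem lam_pos (hconn : G.Connected) (hcard : 3 ≤ Fintype.card V) : 0 < lam := by
  obtain ⟨v, a, b, hab, hva, hvb⟩ := hconn.exists_two_neighbors hcard
  exact hy.pos_of_adj hva

theorem one_lt (hconn : G.Connected) (hcard : 3 ≤ Fintype.card V) : 1 < lam := by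
  nlinarith [hy.two_le_sq hconn hcard, hy.lam_pos hconn hcard]

omit [DecidableEq V] in
theorem const_mul {c : ℝ} (hc : 0 < c) : G.IsPerronVector lam fun v => c * y v where
  pos v := mul_pos hc (hy.pos v)
  sum_eq v := by rw [← Finset.mul_sum, hy.sum_eq]; ring

end IsPerronVector

end PerronVector

/-! ### Growth of ball weights against powers of the eigenvalue -/

section Slack

variable {V : Type*} [Fintype V] [DecidableEq V] (G : SimpleGraph V) [DecidableRel G.Adj]

/-- The total weight of `f` on the ball of radius `k` around `v`. -/
noncomputable def ballSum (f : V → ℝ) (k : ℕ) (v : V) : ℝ :=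
  ∑ u, if G.dist v u ≤ k then f u else 0

/-- The amount by which `lam ^ k * y v + 1` exceeds the weight of `f` on the ball of radius `k`. -/
noncomputable def slack (lam : ℝ) (y f : V → ℝ) (k : ℕ) (v : V) : ℝ :=
  lam ^ k * y v + 1 - G.ballSum f k v

variable {G}

omit [Fintype V] [DecidableEq V] [DecidableRel G.Adj] in
theorem Connected.exists_adj_dist_le (hconn : G.Connected) {v u : V} {k : ℕ}
    (h : G.dist v u ≤ k + 1) (hne : v ≠ u) : ∃ w, G.Adj v w ∧ G.dist w u ≤ k := by
  obtain ⟨p, hp⟩ := hconn.exists_walk_length_eq_dist v u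
  cases p with
  | nil => exact absurd rfl hne
  | cons hvw q =>
    refine ⟨_, hvw, (dist_le q).trans ?_⟩
    rw [Walk.length_cons] at hp
    omega

omit [Fintype V] [DecidableEq V] [DecidableRel G.Adj] in
theorem Connected.dist_le_succ (hconn : G.Connected) {v w u : V} {k : ℕ} (hvw : G.Adj v w)
    (h : G.dist v u ≤ k) : G.dist w u ≤ k + 1 := by
  have := hconn.dist_triangle (u := w) (v := v) (w := u)
  rw [dist_eq_one_iff_adj.2 hvw.symm] at this
  omega

/-- A vertex within `k` of `v` is within `k + 1` of every neighbor of `v`, so it is counted `degree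
v` times on the right; a vertex at distance `k + 1` or `k + 2` is counted at least once. -/
theorem Connected.ballSum_add_le (hconn : G.Connected) {f : V → ℝ} (hf : ∀ v, 0 ≤ f v) (k : ℕ)
    (v : V) :
    G.ballSum f (k + 2) v + ((G.degree v : ℝ) - 1) * G.ballSum f k v ≤
      ∑ w ∈ G.neighborFinset v, G.ballSum f (k + 1) w := by
  simp only [ballSum]
  rw [Finset.sum_comm, Finset.mul_sum, ← Finset.sum_add_distrib]
  refine Finset.sum_le_sum fun u _ => ?_
  by_cases h1 : G.dist v u ≤ k
  · rw [if_pos h1, if_pos (by omega), Finset.sum_congr rfl fun w hw => if_pos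
      (hconn.dist_le_succ ((mem_neighborFinset _ _ _).1 hw) h1)]
    simp only [Finset.sum_const, card_neighborFinset_eq_degree, nsmul_eq_mul]
    linarith
  · rw [if_neg h1, mul_zero, add_zero]
    have hnn : ∀ w ∈ G.neighborFinset v, 0 ≤ if G.dist w u ≤ k + 1 then f u else 0 := by
      intro w _
      split_ifs
      exacts [hf u, le_rfl]
    by_cases h2 : G.dist v u ≤ k + 2
    · rw [if_pos h2]
      obtain ⟨w, hvw, hw⟩ := hconn.exists_adj_dist_le h2 (by rintro rfl; simp at h1)
      refine le_trans ?_ (Finset.single_le_sum hnn ((mem_neighborFinset _ _ _).2 hvw))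
      rw [if_pos hw]
    · rw [if_neg h2]
      exact Finset.sum_nonneg hnn

omit [DecidableRel G.Adj] in
theorem Connected.ballSum_zero (hconn : G.Connected) (f : V → ℝ) (v : V) :
    G.ballSum f 0 v = f v := by
  simp [ballSum, hconn.dist_eq_zero_iff]

theorem Connected.ballSum_one (hconn : G.Connected) (f : V → ℝ) (v : V) :
    G.ballSum f 1 v = f v + ∑ w ∈ G.neighborFinset v, f w := by
  have hfilter : (Finset.univ.filter fun u => G.dist v u ≤ 1) = insert v (G.neighborFinset v) := by
    ext u
    simp only [Finset.mem_filter, Finset.mem_univ, true_and, Finset.mem_insert, mem_neighborFinset]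
    rw [Nat.le_one_iff_eq_zero_or_eq_one, hconn.dist_eq_zero_iff, dist_eq_one_iff_adj, eq_comm]
  rw [ballSum, ← Finset.sum_filter, hfilter, Finset.sum_insert (by simp)]

namespace IsPerronVector

variable {lam : ℝ} {y f : V → ℝ}

/-- The constant 1 in the slack satisfies the ball recursion exactly, since `degree v - (degree v -
1) = 1`, and `lam ^ k * y v` satisfies it up to the extra term `(degree v - 1) * (lam ^ k * y v)`.
-/
theorem le_slack_add_two (hy : G.IsPerronVector lam y) (hconn : G.Connected)
    (hf : ∀ v, 0 ≤ f v) (k : ℕ) (v : V) :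
    ∑ w ∈ G.neighborFinset v, G.slack lam y f (k + 1) w
      - ((G.degree v : ℝ) - 1) * G.slack lam y f k v + ((G.degree v : ℝ) - 1) * (lam ^ k * y v)
      ≤ G.slack lam y f (k + 2) v := by
  have h := hconn.ballSum_add_le hf k v
  simp only [slack, Finset.sum_sub_distrib, Finset.sum_add_distrib, Finset.sum_const,
    card_neighborFinset_eq_degree, nsmul_eq_mul, ← Finset.mul_sum, hy.sum_eq]
  ring_nf at h ⊢
  linarith

/-- The vertex recursion in terms of increments along directed edges: the increment along `u → w` is
controlled by those along `w → x` with `x ≠ u`. -/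
theorem sum_le_slack_sub_slack (hy : G.IsPerronVector lam y) (hconn : G.Connected)
    (hf : ∀ v, 0 ≤ f v) (k : ℕ) {u w : V} (huw : G.Adj u w) :
    ∑ x ∈ (G.neighborFinset w).erase u,
        (G.slack lam y f (k + 1) x - G.slack lam y f k w + lam ^ k * y w)
      ≤ G.slack lam y f (k + 2) w - G.slack lam y f (k + 1) u := by
  have hu : u ∈ G.neighborFinset w := by simpa using huw.symm
  have hdeg : 0 < G.degree w := by
    rw [← card_neighborFinset_eq_degree]
    exact Finset.card_pos.2 ⟨u, hu⟩
  have h := hy.le_slack_add_two hconn hf k w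
  rw [← Finset.add_sum_erase _ _ hu] at h
  have hc : (((G.neighborFinset w).erase u).card : ℝ) = (G.degree w : ℝ) - 1 := by
    rw [Finset.card_erase_of_mem hu, card_neighborFinset_eq_degree, Nat.cast_sub hdeg, Nat.cast_one]
  rw [Finset.sum_add_distrib, Finset.sum_sub_distrib, Finset.sum_const, Finset.sum_const,
    nsmul_eq_mul, nsmul_eq_mul, hc]
  linarith

theorem sum_erase_eq (hy : G.IsPerronVector lam y) {u w : V} (huw : G.Adj u w) :
    ∑ x ∈ (G.neighborFinset w).erase u, y x = lam * y w - y u := by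
  rw [← hy.sum_eq, ← Finset.add_sum_erase _ _ (show u ∈ G.neighborFinset w by simpa using huw.symm)]
  ring

theorem neg_le_slack_one_sub (hy : G.IsPerronVector lam y) (hconn : G.Connected)
    (hfy : ∀ v, f v ≤ y v) {u w : V} (huw : G.Adj u w) :
    -f w ≤ G.slack lam y f 1 w - G.slack lam y f 0 u := by
  have hu : u ∈ G.neighborFinset w := by simpa using huw.symm
  have h1 : ∑ x ∈ (G.neighborFinset w).erase u, f x ≤ ∑ x ∈ (G.neighborFinset w).erase u, y x :=
    Finset.sum_le_sum fun x _ => hfy x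
  rw [hy.sum_erase_eq huw] at h1
  rw [slack, slack, hconn.ballSum_one, hconn.ballSum_zero, ← Finset.add_sum_erase _ _ hu]
  linarith

theorem neg_pow_mul_le_slack_sub (hy : G.IsPerronVector lam y) (hconn : G.Connected)
    (hf : ∀ v, 0 ≤ f v) (hfy : ∀ v, f v ≤ y v) (k : ℕ) {u w : V} (huw : G.Adj u w) :
    -(lam ^ k * y w) ≤ G.slack lam y f (k + 1) w - G.slack lam y f k u := by
  induction k generalizing u w with
  | zero =>
    have := hy.neg_le_slack_one_sub hconn hfy huw
    have := hfy w
    simp only [pow_zero, one_mul]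
    linarith
  | succ k ih =>
    refine le_trans ?_ (hy.sum_le_slack_sub_slack hconn hf k huw)
    have hlam := hy.pos_of_adj huw
    have : ∑ x ∈ (G.neighborFinset w).erase u, -(lam ^ k * y x) ≤
        ∑ x ∈ (G.neighborFinset w).erase u,
          (G.slack lam y f (k + 1) x - G.slack lam y f k w + lam ^ k * y w) := by
      refine Finset.sum_le_sum fun x hx => ?_
      have := ih (show G.Adj w x by simpa using Finset.mem_of_mem_erase hx)
      have : 0 ≤ lam ^ k * y w := mul_nonneg (pow_pos hlam k).le (hy.pos w).le
      linarith
    refine le_trans ?_ this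
    rw [Finset.sum_neg_distrib, ← Finset.mul_sum, hy.sum_erase_eq huw]
    have : 0 ≤ lam ^ k * y u := mul_nonneg (pow_pos hlam k).le (hy.pos u).le
    rw [pow_succ]
    linarith

theorem mul_sub_le_slack_sub (hy : G.IsPerronVector lam y) (hconn : G.Connected)
    (hf : ∀ v, 0 ≤ f v) (hfy : ∀ v, f v ≤ y v) (k : ℕ) {u w : V} (huw : G.Adj u w) :
    lam ^ k * y w * ((G.degree w : ℝ) - 1 - lam) ≤
      G.slack lam y f (k + 2) w - G.slack lam y f (k + 1) u := by
  have hu : u ∈ G.neighborFinset w := by simpa using huw.symm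
  have hdeg : 0 < G.degree w := by
    rw [← card_neighborFinset_eq_degree]
    exact Finset.card_pos.2 ⟨u, hu⟩
  have hc : (((G.neighborFinset w).erase u).card : ℝ) = (G.degree w : ℝ) - 1 := by
    rw [Finset.card_erase_of_mem hu, card_neighborFinset_eq_degree, Nat.cast_sub hdeg, Nat.cast_one]
  refine le_trans ?_ (hy.sum_le_slack_sub_slack hconn hf k huw)
  have hlam := hy.pos_of_adj huw
  have : ∑ x ∈ (G.neighborFinset w).erase u, (-(lam ^ k * y x) + lam ^ k * y w) ≤
      ∑ x ∈ (G.neighborFinset w).erase u,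
        (G.slack lam y f (k + 1) x - G.slack lam y f k w + lam ^ k * y w) := by
    refine Finset.sum_le_sum fun x hx => ?_
    have := hy.neg_pow_mul_le_slack_sub hconn hf hfy k
      (show G.Adj w x by simpa using Finset.mem_of_mem_erase hx)
    linarith
  refine le_trans ?_ this
  rw [Finset.sum_add_distrib, Finset.sum_neg_distrib, ← Finset.mul_sum, hy.sum_erase_eq huw,
    Finset.sum_const, nsmul_eq_mul, hc]
  have : 0 ≤ lam ^ k * y u := mul_nonneg (pow_pos hlam k).le (hy.pos u).le
  linarith

theorem mul_sub_one_le_slack_sub_of_neg_pow_le (hy : G.IsPerronVector lam y)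
    (hconn : G.Connected) (hf : ∀ v, 0 ≤ f v) (k : ℕ)
    (hk : ∀ u w, G.Adj u w → -lam ^ k ≤ G.slack lam y f (k + 1) w - G.slack lam y f k u)
    {u w : V} (huw : G.Adj u w) :
    lam ^ k * ((G.degree w : ℝ) - 1) * (y w - 1) ≤
      G.slack lam y f (k + 2) w - G.slack lam y f (k + 1) u := by
  have hu : u ∈ G.neighborFinset w := by simpa using huw.symm
  have hdeg : 0 < G.degree w := by
    rw [← card_neighborFinset_eq_degree]
    exact Finset.card_pos.2 ⟨u, hu⟩
  have hc : (((G.neighborFinset w).erase u).card : ℝ) = (G.degree w : ℝ) - 1 := by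
    rw [Finset.card_erase_of_mem hu, card_neighborFinset_eq_degree, Nat.cast_sub hdeg, Nat.cast_one]
  refine le_trans ?_ (hy.sum_le_slack_sub_slack hconn hf k huw)
  have : ∑ x ∈ (G.neighborFinset w).erase u, (-lam ^ k + lam ^ k * y w) ≤
      ∑ x ∈ (G.neighborFinset w).erase u,
        (G.slack lam y f (k + 1) x - G.slack lam y f k w + lam ^ k * y w) := by
    refine Finset.sum_le_sum fun x hx => ?_
    have := hk w x (by simpa using Finset.mem_of_mem_erase hx)
    linarith
  refine le_trans (le_of_eq ?_) this
  rw [Finset.sum_const, nsmul_eq_mul, hc]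
  ring

/-- If both bounds lay below `-(M * l) / 4`, multiplying them would contradict `t * (1 - t) ≤ 1 / 4`
and `c * (l - c) ≤ l ^ 2 / 4`. -/
theorem neg_quarter_le_of_le {M c l t D : ℝ} (hM : 0 < M) (hc : 0 ≤ c) (hl : 0 < l) (ht : 0 ≤ t)
    (h1 : M * t * (c - l) ≤ D) (h2 : M * c * (t - 1) ≤ D) : -(M * l) / 4 ≤ D := by
  obtain ⟨d, rfl⟩ : ∃ d, D = M * d := ⟨D / M, by field_simp⟩
  have h1 : t * (c - l) ≤ d := le_of_mul_le_mul_left (by linarith) hM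
  have h2 : c * (t - 1) ≤ d := le_of_mul_le_mul_left (by linarith) hM
  have : -l / 4 ≤ d := by
    by_contra! hd
    have ha : l / 4 < t * (l - c) := by linarith
    have hb : l / 4 < c * (1 - t) := by linarith
    have hab : l / 4 * (l / 4) < t * (l - c) * (c * (1 - t)) :=
      mul_lt_mul'' ha hb (by positivity) (by positivity)
    have hlc : 0 < l - c := pos_of_mul_pos_right (lt_trans (by positivity) ha) ht
    have e1 : t * (1 - t) ≤ 1 / 4 := by nlinarith [sq_nonneg (t - 1 / 2)]
    have e2 : c * (l - c) ≤ l ^ 2 / 4 := by nlinarith [sq_nonneg (c - l / 2)]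
    have e3 : t * (1 - t) * (c * (l - c)) ≤ 1 / 4 * (c * (l - c)) :=
      mul_le_mul_of_nonneg_right e1 (mul_nonneg hc hlc.le)
    nlinarith
  nlinarith

theorem neg_quarter_pow_le_slack_sub_of_neg_pow_le (hy : G.IsPerronVector lam y)
    (hconn : G.Connected) (hf : ∀ v, 0 ≤ f v) (hfy : ∀ v, f v ≤ y v) (k : ℕ)
    (hk : ∀ u w, G.Adj u w → -lam ^ k ≤ G.slack lam y f (k + 1) w - G.slack lam y f k u)
    {u w : V} (huw : G.Adj u w) :
    -lam ^ (k + 1) / 4 ≤ G.slack lam y f (k + 2) w - G.slack lam y f (k + 1) u := by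
  have hlam := hy.pos_of_adj huw
  have hdeg : 0 < G.degree w := (G.degree_pos_iff_exists_adj w).2 ⟨u, huw.symm⟩
  have hc : (1 : ℝ) ≤ G.degree w := by exact_mod_cast hdeg
  rw [pow_succ]
  exact neg_quarter_le_of_le (pow_pos hlam k) (sub_nonneg.2 hc) hlam (hy.pos w).le
    (hy.mul_sub_le_slack_sub hconn hf hfy k huw)
    (hy.mul_sub_one_le_slack_sub_of_neg_pow_le hconn hf k hk huw)

/-- The induction sustains itself: this bound at `k` yields the four times stronger one at `k + 1`.
-/
theorem neg_pow_le_slack_sub (hy : G.IsPerronVector lam y) (hconn : G.Connected)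
    (hf : ∀ v, 0 ≤ f v) (hf1 : ∀ v, f v ≤ 1) (hfy : ∀ v, f v ≤ y v) (k : ℕ) (u w : V)
    (huw : G.Adj u w) : -lam ^ k ≤ G.slack lam y f (k + 1) w - G.slack lam y f k u := by
  induction k generalizing u w with
  | zero =>
    have := hy.neg_le_slack_one_sub hconn hfy huw
    have := hf1 w
    simp only [pow_zero, zero_add]
    linarith
  | succ k ih =>
    have := hy.neg_quarter_pow_le_slack_sub_of_neg_pow_le hconn hf hfy k ih huw
    have := pow_pos (hy.pos_of_adj huw) (k + 1)
    linarith

/-- The gain `(degree v - 1) * lam ^ (k + 1)` beats the loss of at most `degree v * lam ^ (k + 1) /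
4` once `degree v ≥ 2`. At a leaf the gain vanishes, but its neighbor `w` has `y w = lam * y v > 1`,
which makes the single increment positive. -/
theorem slack_lt_slack_add_two (hy : G.IsPerronVector lam y) (hconn : G.Connected)
    (hcard : 3 ≤ Fintype.card V) (hf : ∀ v, 0 ≤ f v) (hf1 : ∀ v, f v ≤ 1) (hfy : ∀ v, f v ≤ y v)
    (k : ℕ) {v : V} (hv : 1 ≤ y v) :
    G.slack lam y f (k + 1) v < G.slack lam y f (k + 3) v := by
  have : Nontrivial V := Fintype.one_lt_card_iff_nontrivial.1 (by omega)
  have hdeg : 0 < G.degree v :=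
    (G.degree_pos_iff_exists_adj v).2 (hconn.preconnected.exists_adj_of_nontrivial v)
  have hlam := hy.one_lt hconn hcard
  have hpow : 0 < lam ^ k := pow_pos (by linarith) k
  have hpow' : 0 < lam ^ (k + 1) := pow_pos (by linarith) _
  have hle := hy.le_slack_add_two hconn hf (k + 1) v
  have hk := hy.neg_pow_le_slack_sub hconn hf hf1 hfy k
  have hsum : ∑ w ∈ G.neighborFinset v, G.slack lam y f (k + 1 + 1) w =
      ∑ w ∈ G.neighborFinset v, (G.slack lam y f (k + 2) w - G.slack lam y f (k + 1) v) +
        G.degree v * G.slack lam y f (k + 1) v := by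
    rw [Finset.sum_sub_distrib, Finset.sum_const, card_neighborFinset_eq_degree, nsmul_eq_mul]
    ring
  suffices 0 < ∑ w ∈ G.neighborFinset v,
      (G.slack lam y f (k + 2) w - G.slack lam y f (k + 1) v) +
        ((G.degree v : ℝ) - 1) * lam ^ (k + 1) by
    have h2 : ((G.degree v : ℝ) - 1) * lam ^ (k + 1) ≤
        ((G.degree v : ℝ) - 1) * (lam ^ (k + 1) * y v) := by
      have : (1 : ℝ) ≤ G.degree v := by exact_mod_cast hdeg
      exact mul_le_mul_of_nonneg_left (le_mul_of_one_le_right hpow'.le hv) (by linarith)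
    rw [hsum] at hle
    linarith
  obtain h1 | h1 : G.degree v = 1 ∨ 2 ≤ G.degree v := by omega
  · obtain ⟨w, hw⟩ := Finset.card_eq_one.1 ((G.card_neighborFinset_eq_degree v).trans h1)
    have hvw : G.Adj v w := by rw [← mem_neighborFinset, hw]; simp
    have hyw : y w = lam * y v := by rw [← hy.sum_eq, hw, Finset.sum_singleton]
    -- Otherwise `v` and `w` would form a whole component, leaving no room for a vertex with two
    -- neighbors.
    have hdw : 2 ≤ G.degree w := by
      by_contra! hlt
      obtain ⟨z, a, b, hab, hza, hzb⟩ := hconn.exists_two_neighbors hcard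
      have hz2 : 2 ≤ G.degree z := by
        rw [← card_neighborFinset_eq_degree, ← Finset.card_pair hab]
        refine Finset.card_le_card ?_
        intro x
        simp only [Finset.mem_insert, Finset.mem_singleton, mem_neighborFinset]
        rintro (rfl | rfl) <;> assumption
      have hN : ∀ x, G.Adj v x → x = w := fun x hx => by
        rw [← mem_neighborFinset, hw] at hx
        simpa using hx
      have hNw : ∀ x, G.Adj w x → x = v := fun x hx => by
        have := Finset.card_le_one.1
          (show (G.neighborFinset w).card ≤ 1 by rw [card_neighborFinset_eq_degree]; omega)
        exact this x (by simpa using hx) v (by simpa using hvw.symm)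
      have := hconn.forall_of_adj_closed (p := fun x => x = v ∨ x = w) (by
        rintro a b (rfl | rfl) hab
        · exact Or.inr (hN _ hab)
        · exact Or.inl (hNw _ hab)) (Or.inl rfl) z
      rcases this with rfl | rfl <;> omega
    have hD := hy.mul_sub_one_le_slack_sub_of_neg_pow_le hconn hf k hk hvw
    rw [hw, Finset.sum_singleton, h1]
    have hdw' : (2 : ℝ) ≤ G.degree w := by exact_mod_cast hdw
    have : 0 < lam ^ k * ((G.degree w : ℝ) - 1) * (y w - 1) := by
      refine mul_pos (mul_pos hpow (by linarith)) ?_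
      rw [hyw]
      nlinarith
    push_cast
    linarith
  · have h1' : (2 : ℝ) ≤ G.degree v := by exact_mod_cast h1
    have : ∑ w ∈ G.neighborFinset v, -lam ^ (k + 1) / 4 ≤
        ∑ w ∈ G.neighborFinset v, (G.slack lam y f (k + 2) w - G.slack lam y f (k + 1) v) :=
      Finset.sum_le_sum fun w hw =>
        hy.neg_quarter_pow_le_slack_sub_of_neg_pow_le hconn hf hfy k hk (by simpa using hw)
    rw [Finset.sum_const, card_neighborFinset_eq_degree, nsmul_eq_mul] at this
    nlinarith

theorem slack_nonneg (hy : G.IsPerronVector lam y) (hconn : G.Connected)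
    (hcard : 3 ≤ Fintype.card V) (hf : ∀ v, 0 ≤ f v) (hf1 : ∀ v, f v ≤ 1) (hfy : ∀ v, f v ≤ y v)
    (k : ℕ) {v : V} (hv : 1 ≤ y v) : 0 ≤ G.slack lam y f k v := by
  have h1 := hf1 v
  induction k using Nat.twoStepInduction with
  | zero =>
    rw [slack, hconn.ballSum_zero]
    linarith
  | one =>
    have h2 : ∑ w ∈ G.neighborFinset v, f w ≤ ∑ w ∈ G.neighborFinset v, y w :=
      Finset.sum_le_sum fun w _ => hfy w
    rw [hy.sum_eq] at h2
    rw [slack, hconn.ballSum_one]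
    linarith
  | more k ih _ =>
    cases k with
    | zero =>
      -- Radius 2 is not reached by the strict growth lemma; the increment bound `-1` at `k = 0`
      -- suffices because the slack at radius 0 is at least 1.
      have : Nontrivial V := Fintype.one_lt_card_iff_nontrivial.1 (by omega)
      have hdeg : 0 < G.degree v :=
        (G.degree_pos_iff_exists_adj v).2 (hconn.preconnected.exists_adj_of_nontrivial v)
      have hdeg' : (1 : ℝ) ≤ G.degree v := by exact_mod_cast hdeg
      have hle := hy.le_slack_add_two hconn hf 0 v
      have hs : ∑ w ∈ G.neighborFinset v, (-1 + G.slack lam y f 0 v) ≤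
          ∑ w ∈ G.neighborFinset v, G.slack lam y f (0 + 1) w :=
        Finset.sum_le_sum fun w hw => by
          have := hy.neg_pow_le_slack_sub hconn hf hf1 hfy 0 v w (by simpa using hw)
          rw [pow_zero] at this
          linarith
      rw [Finset.sum_const, card_neighborFinset_eq_degree, nsmul_eq_mul] at hs
      have h0 : G.slack lam y f 0 v = y v + 1 - f v := by
        rw [slack, hconn.ballSum_zero, pow_zero, one_mul]
      rw [h0] at hle hs
      rw [pow_zero, one_mul] at hle
      nlinarith
    | succ k => exact ih.trans (hy.slack_lt_slack_add_two hconn hcard hf hf1 hfy k hv).le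

theorem ballSum_le (hy : G.IsPerronVector lam y) (hconn : G.Connected)
    (hcard : 3 ≤ Fintype.card V) (hf : ∀ v, 0 ≤ f v) (hf1 : ∀ v, f v ≤ 1) (hfy : ∀ v, f v ≤ y v)
    (k : ℕ) {v : V} (hv : y v = 1) : G.ballSum f k v ≤ lam ^ k + 1 := by
  have := hy.slack_nonneg hconn hcard hf hf1 hfy k hv.ge
  rw [slack, hv] at this
  linarith

theorem ballSum_lt (hy : G.IsPerronVector lam y) (hconn : G.Connected)
    (hcard : 3 ≤ Fintype.card V) (hf : ∀ v, 0 ≤ f v) (hf1 : ∀ v, f v ≤ 1) (hfy : ∀ v, f v ≤ y v)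
    {k : ℕ} (hk : 3 ≤ k) {v : V} (hv : y v = 1) : G.ballSum f k v < lam ^ k + 1 := by
  obtain ⟨k, rfl⟩ := Nat.exists_eq_add_of_le' hk
  have h1 := hy.slack_nonneg hconn hcard hf hf1 hfy (k + 1) hv.ge
  have h2 := hy.slack_lt_slack_add_two hconn hcard hf hf1 hfy k hv.ge
  rw [slack, slack, hv] at h2
  rw [slack, hv] at h1
  linarith

end IsPerronVector

end Slack

/-! ### Greedy coloring -/

section Degenerate

variable {V : Type*} [DecidableEq V] {H : SimpleGraph V} [DecidableRel H.Adj]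

/-- The vertex chosen for the whole of `Q` is colored last. Counting colors rather than vertices on
the `P` side lets repeated colors be exploited. -/
theorem exists_coloring_extension {m : ℕ} {P : Finset V} {c : V → ℕ} (hc : ∀ x ∈ P, c x < m)
    (hproper : ∀ x ∈ P, ∀ z ∈ P, H.Adj x z → c x ≠ c z) (Q : Finset V) (hPQ : Disjoint P Q)
    (hQ : ∀ R ⊆ Q, R.Nonempty →
      ∃ x ∈ R, (R.filter (H.Adj x)).card + ((P.filter (H.Adj x)).image c).card < m) :
    ∃ c' : V → ℕ, (∀ x ∈ P, c' x = c x) ∧ (∀ x ∈ P ∪ Q, c' x < m) ∧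
      ∀ x ∈ P ∪ Q, ∀ z ∈ P ∪ Q, H.Adj x z → c' x ≠ c' z := by
  induction Q using Finset.strongInduction with
  | H Q ih =>
    obtain rfl | hne := Q.eq_empty_or_nonempty
    · exact ⟨c, fun _ _ => rfl, by simpa using hc, by simpa using hproper⟩
    obtain ⟨x, hxQ, hx⟩ := hQ Q subset_rfl hne
    obtain ⟨c', hc'P, hc'm, hc'⟩ := ih (Q.erase x) (Finset.erase_ssubset hxQ)
      (hPQ.mono_right (Finset.erase_subset _ _))
      fun R hR => hQ R (hR.trans (Finset.erase_subset _ _))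
    have hxP : x ∉ P := fun h => Finset.disjoint_left.1 hPQ h hxQ
    set used : Finset ℕ :=
      (Q.filter (H.Adj x)).image c' ∪ (P.filter (H.Adj x)).image c with hused
    have hcard : used.card < (Finset.range m).card := by
      rw [Finset.card_range]
      refine (Finset.card_union_le _ _).trans_lt (lt_of_le_of_lt ?_ hx)
      exact Nat.add_le_add_right Finset.card_image_le _
    obtain ⟨a, ham, ha⟩ := Finset.exists_mem_notMem_of_card_lt_card hcard
    have hmem : ∀ z ∈ P ∪ Q, H.Adj x z → c' z ≠ a := by
      rintro z hz hxz rfl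
      apply ha
      rw [hused, Finset.mem_union]
      by_cases hzP : z ∈ P
      · right
        rw [hc'P z hzP]
        exact Finset.mem_image_of_mem _ (Finset.mem_filter.2 ⟨hzP, hxz⟩)
      · left
        have hzQ : z ∈ Q := (Finset.mem_union.1 hz).resolve_left hzP
        exact Finset.mem_image_of_mem _ (Finset.mem_filter.2 ⟨hzQ, hxz⟩)
    have hsub : ∀ z ∈ P ∪ Q, z ≠ x → z ∈ P ∪ Q.erase x := by
      intro z hz hzx
      simp only [Finset.mem_union, Finset.mem_erase] at hz ⊢
      tauto
    refine ⟨Function.update c' x a, fun z hz => ?_, fun z hz => ?_, fun z hz w hw hzw => ?_⟩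
    · rw [Function.update_of_ne (by rintro rfl; exact hxP hz), hc'P z hz]
    · obtain rfl | hzx := eq_or_ne z x
      · simpa using ham
      · rw [Function.update_of_ne hzx]
        exact hc'm z (hsub z hz hzx)
    · obtain rfl | hzx := eq_or_ne z x
      · rw [Function.update_self, Function.update_of_ne hzw.ne']
        exact (hmem w hw hzw).symm
      · rw [Function.update_of_ne hzx]
        obtain rfl | hwx := eq_or_ne w x
        · rw [Function.update_self]
          exact hmem z hz hzw.symm
        · rw [Function.update_of_ne hwx]
          exact hc' z (hsub z hz hzx) w (hsub w hw hwx) hzw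

theorem exists_coloring_of_degenerate {m : ℕ} (Q : Finset V)
    (hQ : ∀ R ⊆ Q, R.Nonempty → ∃ x ∈ R, (R.filter (H.Adj x)).card < m) :
    ∃ c : V → ℕ, (∀ x ∈ Q, c x < m) ∧ ∀ x ∈ Q, ∀ z ∈ Q, H.Adj x z → c x ≠ c z := by
  obtain ⟨c, -, h1, h2⟩ := exists_coloring_extension (H := H) (m := m) (P := ∅) (c := fun _ => 0)
    (by simp) (by simp) Q (by simp) (by simpa using hQ)
  exact ⟨c, by simpa using h1, by simpa using h2⟩

omit [DecidableEq V] [DecidableRel H.Adj] in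
theorem colorable_of_coloring_nat {m : ℕ} {c : V → ℕ} (hc : ∀ x, c x < m)
    (hproper : ∀ x z, H.Adj x z → c x ≠ c z) : H.Colorable m :=
  ⟨Coloring.mk (fun x => (⟨c x, hc x⟩ : Fin m)) fun {x z} h => by
    simpa [Fin.ext_iff] using hproper x z h⟩

theorem exists_le_card_of_not_colorable [Fintype V] {m : ℕ} (h : ¬ H.Colorable m) :
    ∃ U : Finset V, U.Nonempty ∧ ∀ x ∈ U, m ≤ (U.filter (H.Adj x)).card := by
  by_contra! hU
  obtain ⟨c, h1, h2⟩ := exists_coloring_of_degenerate (H := H) (m := m) Finset.univ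
    fun R _ hR => hU R hR
  exact h (colorable_of_coloring_nat (by simpa using h1) (by simpa using h2))

end Degenerate

/-! ### The upper bounds on the distance chromatic number -/

section Bound

variable {V : Type*} [Fintype V] [DecidableEq V] {G : SimpleGraph V} [DecidableRel G.Adj]

omit [Fintype V] [DecidableEq V] [DecidableRel G.Adj] in
theorem Connected.distPower_adj (hconn : G.Connected) {γ : ℕ} {u v : V} :
    (G.distPower γ).Adj u v ↔ u ≠ v ∧ G.dist u v ≤ γ := by
  change u ≠ v ∧ G.edist u v ≤ γ ↔ _
  rw [← (hconn.preconnected u v).coe_dist_eq_edist, Nat.cast_le]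

omit [DecidableEq V] [DecidableRel G.Adj] in
theorem distChromaticNumber_le_iff {γ m : ℕ} :
    G.distChromaticNumber γ ≤ m ↔ (G.distPower γ).Colorable m := by
  rw [← chromaticNumber_le_iff_colorable, ← natCast_distChromaticNumber, Nat.cast_le]

omit [DecidableEq V] [DecidableRel G.Adj] in
theorem distChromaticNumber_pos [Nonempty V] (γ : ℕ) : 0 < G.distChromaticNumber γ := by
  rw [Nat.pos_iff_ne_zero]
  intro h
  obtain ⟨c⟩ := distChromaticNumber_le_iff.1 h.le
  exact (c (Classical.arbitrary V)).elim0

theorem IsPerronVector.exists_distChromaticNumber_le_ballSum {lam : ℝ} {y : V → ℝ}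
    (hy : G.IsPerronVector lam y) (hconn : G.Connected) (γ : ℕ) :
    ∃ (y' f : V → ℝ) (v : V), G.IsPerronVector lam y' ∧ (∀ v, 0 ≤ f v) ∧ (∀ v, f v ≤ 1) ∧
      (∀ v, f v ≤ y' v) ∧ y' v = 1 ∧ (G.distChromaticNumber γ : ℝ) ≤ G.ballSum f γ v := by
  classical
  have := hconn.nonempty
  obtain ⟨m, hm⟩ := Nat.exists_eq_add_of_le' (G.distChromaticNumber_pos γ)
  have hnot : ¬ (G.distPower γ).Colorable m := by
    rw [← distChromaticNumber_le_iff]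
    omega
  obtain ⟨U, hU, hdeg⟩ := exists_le_card_of_not_colorable hnot
  obtain ⟨v, hvU, hmin⟩ := U.exists_min_image y hU
  have hv := hy.pos v
  -- Normalizing at the minimizer over `U` makes the indicator of `U` lie below the Perron vector.
  refine ⟨fun x => (y v)⁻¹ * y x, fun x => if x ∈ U then 1 else 0, v,
    hy.const_mul (inv_pos.2 hv), fun x => ?_, fun x => ?_, fun x => ?_, by field_simp, ?_⟩
  · dsimp only; split_ifs <;> norm_num
  · dsimp only; split_ifs <;> norm_num
  · dsimp only
    split_ifs with hx
    · rw [inv_mul_eq_div, one_le_div hv]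
      exact hmin x hx
    · exact mul_nonneg (inv_pos.2 hv).le (hy.pos x).le
  · have hball : G.ballSum (fun x => if x ∈ U then 1 else 0) γ v =
        ((U.filter fun x => G.dist v x ≤ γ).card : ℝ) := by
      rw [ballSum, Finset.natCast_card_filter, ← Finset.sum_filter, ← Finset.sum_filter,
        ← Finset.sum_filter, Finset.filter_filter, Finset.sum_const, Finset.sum_const]
      congr 2
      ext x
      simp [and_comm]
    rw [hball, hm]
    have hins : insert v (U.filter ((G.distPower γ).Adj v)) ⊆ U.filter fun x => G.dist v x ≤ γ := by
      intro x
      simp only [Finset.mem_insert, Finset.mem_filter, hconn.distPower_adj]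
      rintro (rfl | h)
      · exact ⟨hvU, by simp⟩
      · exact ⟨h.1, h.2.2⟩
    have := Finset.card_le_card hins
    rw [Finset.card_insert_of_notMem (by simp)] at this
    exact_mod_cast (Nat.add_le_add_right (hdeg v hvU) 1).trans this

theorem Connected.distChromaticNumber_le (hconn : G.Connected) (hcard : 3 ≤ Fintype.card V)
    (γ : ℕ) : (G.distChromaticNumber γ : ℝ) ≤ G.lambdaOne ^ γ + 1 := by
  obtain ⟨y, hy⟩ := hconn.exists_isPerronVector
  obtain ⟨y', f, v, hy', hf, hf1, hfy, hv, hle⟩ := hy.exists_distChromaticNumber_le_ballSum hconn γ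
  exact hle.trans (hy'.ballSum_le hconn hcard hf hf1 hfy γ hv)

theorem Connected.distChromaticNumber_lt (hconn : G.Connected) (hcard : 3 ≤ Fintype.card V)
    {γ : ℕ} (hγ : 3 ≤ γ) : (G.distChromaticNumber γ : ℝ) < G.lambdaOne ^ γ + 1 := by
  obtain ⟨y, hy⟩ := hconn.exists_isPerronVector
  obtain ⟨y', f, v, hy', hf, hf1, hfy, hv, hle⟩ := hy.exists_distChromaticNumber_le_ballSum hconn γ
  exact hle.trans_lt (hy'.ballSum_lt hconn hcard hf hf1 hfy hγ hv)

end Bound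

/-! ### Stars and Moore graphs attain equality -/

section EqualityCases

variable {V : Type*} [Fintype V] [DecidableEq V] {G : SimpleGraph V} [DecidableRel G.Adj]

omit [DecidableEq V] [DecidableRel G.Adj] in
theorem distChromaticNumber_eq_card {γ : ℕ} (h : ∀ u v, G.edist u v ≤ γ) :
    G.distChromaticNumber γ = Fintype.card V := by
  have : G.distPower γ = ⊤ := by
    ext u v
    rw [top_adj]
    exact and_iff_left (h u v)
  have h2 := G.natCast_distChromaticNumber γ
  rw [this, chromaticNumber_top] at h2
  exact_mod_cast h2

theorem lambdaOne_eq_of_isRegularOfDegree (hconn : G.Connected) {d : ℕ}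
    (hd : G.IsRegularOfDegree d) : G.lambdaOne = d := by
  obtain ⟨y, hy⟩ := hconn.exists_isPerronVector
  obtain ⟨v, -, hv⟩ := Finset.univ.exists_max_image y
    (Finset.univ_nonempty_iff.2 hconn.nonempty)
  obtain ⟨u, -, hu⟩ := Finset.univ.exists_min_image y
    (Finset.univ_nonempty_iff.2 hconn.nonempty)
  have h1 : G.lambdaOne * y v ≤ d * y v := by
    rw [← hy.sum_eq, ← hd v, ← card_neighborFinset_eq_degree, ← nsmul_eq_mul]
    exact Finset.sum_le_card_nsmul _ _ _ fun x _ => hv x (Finset.mem_univ x)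
  have h2 : d * y u ≤ G.lambdaOne * y u := by
    rw [← hy.sum_eq, ← hd u, ← card_neighborFinset_eq_degree, ← nsmul_eq_mul]
    exact Finset.card_nsmul_le_sum _ _ _ fun x _ => hu x (Finset.mem_univ x)
  exact le_antisymm (le_of_mul_le_mul_right h1 (hy.pos v)) (le_of_mul_le_mul_right h2 (hy.pos u))

theorem IsMooreGraph.distChromaticNumber_eq {d : ℕ} (h : G.IsMooreGraph d 2) :
    (G.distChromaticNumber 2 : ℝ) = G.lambdaOne ^ 2 + 1 := by
  rw [distChromaticNumber_eq_card fun u v => edist_le_ediam.trans h.ediam_eq.le, h.card_eq,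
    lambdaOne_eq_of_isRegularOfDegree h.connected h.regular]
  cases d with
  | zero => simp
  | succ d =>
    simp only [Finset.sum_range_succ, Finset.range_zero, Finset.sum_empty, pow_zero, pow_one,
      Nat.add_sub_cancel]
    push_cast
    ring

theorem IsStar.distChromaticNumber_eq (hconn : G.Connected) (hcard : 3 ≤ Fintype.card V)
    (h : G.IsStar) : (G.distChromaticNumber 2 : ℝ) = G.lambdaOne ^ 2 + 1 := by
  obtain ⟨r, hr⟩ := h
  have hadj : ∀ x z, G.Adj x z ↔ x ≠ z ∧ (x = r ∨ z = r) := fun x z => by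
    rw [hr, starGraph_adj]
  have hdist : ∀ u, G.edist u r ≤ 1 := fun u => by
    rw [edist_le_one_iff_adj_or_eq, hadj]
    tauto
  rw [distChromaticNumber_eq_card fun u v => ?_]
  swap
  · refine (G.edist_triangle (v := r)).trans ?_
    rw [G.edist_comm (u := r)]
    exact (add_le_add (hdist u) (hdist v)).trans (by norm_num)
  obtain ⟨y, hy⟩ := hconn.exists_isPerronVector
  have hN : G.neighborFinset r = Finset.univ.erase r := by
    ext x
    simp only [mem_neighborFinset, hadj, Finset.mem_erase, Finset.mem_univ, and_true, true_or]
    exact ne_comm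
  have hleaf : ∀ x ∈ G.neighborFinset r, G.lambdaOne * y x = y r := fun x hx => by
    have : G.neighborFinset x = {r} := by
      ext z
      have hxr : x ≠ r := by rintro rfl; simp at hx
      simp only [mem_neighborFinset, hadj, Finset.mem_singleton]
      grind
    rw [← hy.sum_eq, this, Finset.sum_singleton]
  have h1 := Finset.sum_congr rfl hleaf
  rw [← Finset.mul_sum, hy.sum_eq, Finset.sum_const, hN,
    Finset.card_erase_of_mem (Finset.mem_univ r), Finset.card_univ, nsmul_eq_mul,
    Nat.cast_sub (by omega), Nat.cast_one] at h1
  have := hy.pos r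
  have h2 : (G.lambdaOne ^ 2 + 1 - Fintype.card V) * y r = 0 := by linarith
  rcases mul_eq_zero.1 h2 with h3 | h3 <;> linarith

end EqualityCases

/-! ### Local structure forced by equality -/

section Tight

variable {V : Type*} [Fintype V] [DecidableEq V] {G : SimpleGraph V} [DecidableRel G.Adj]

omit [Fintype V] in
theorem distPower_two_adj {u v : V} :
    (G.distPower 2).Adj u v ↔ u ≠ v ∧ (G.Adj u v ∨ ∃ w, G.Adj u w ∧ G.Adj w v) := by
  change u ≠ v ∧ G.edist u v ≤ 2 ↔ _
  rw [← not_lt, two_lt_edist_iff]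
  simp only [Set.eq_empty_iff_forall_notMem, mem_commonNeighbors, G.adj_comm v]
  push Not
  tauto

variable (G) in
/-- The number of walks of length two from `v` to `z`. -/
def numTwoWalks (v z : V) : ℕ := ((G.neighborFinset v).filter fun w => G.Adj w z).card

omit [DecidableEq V] in
theorem numTwoWalks_self (v : V) : G.numTwoWalks v v = G.degree v := by
  rw [numTwoWalks, Finset.filter_true_of_mem, card_neighborFinset_eq_degree]
  intro w hw
  simpa [adj_comm] using hw

omit [DecidableEq V] in
theorem numTwoWalks_pos {v w z : V} (hvw : G.Adj v w) (hwz : G.Adj w z) :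
    0 < G.numTwoWalks v z :=
  Finset.card_pos.2 ⟨w, by simp [hvw, hwz]⟩

omit [DecidableEq V] in
theorem sum_sum_neighborFinset {R : Type*} [CommSemiring R] (g : V → R) (v : V) :
    ∑ w ∈ G.neighborFinset v, ∑ z ∈ G.neighborFinset w, g z =
      ∑ z, (G.numTwoWalks v z : R) * g z := by
  have : ∀ w, ∑ z ∈ G.neighborFinset w, g z = ∑ z, if G.Adj w z then g z else 0 := fun w => by
    rw [neighborFinset_eq_filter, Finset.sum_filter]
  simp_rw [this]
  rw [Finset.sum_comm]
  refine Finset.sum_congr rfl fun z _ => ?_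
  rw [← Finset.sum_filter, Finset.sum_const, nsmul_eq_mul, numTwoWalks]

omit [DecidableEq V] in
theorem sum_degree_neighborFinset (v : V) :
    ∑ w ∈ G.neighborFinset v, G.degree w = ∑ z, G.numTwoWalks v z := by
  simpa using sum_sum_neighborFinset (G := G) (fun _ => (1 : ℕ)) v

omit [DecidableEq V] in
theorem IsPerronVector.sum_numTwoWalks_mul {lam : ℝ} {y : V → ℝ} (hy : G.IsPerronVector lam y)
    (v : V) : ∑ z, (G.numTwoWalks v z : ℝ) * y z = lam ^ 2 * y v := by
  rw [← sum_sum_neighborFinset]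
  simp_rw [hy.sum_eq]
  rw [← Finset.mul_sum, hy.sum_eq]
  ring

variable (G) in
/-- The vertex `v` lies in no triangle or quadrilateral, `y` takes the value `t` at distance two
from `v`, and there are exactly `m` vertices at distance one or two from `v`. -/
structure IsTight (y : V → ℝ) (t : ℝ) (m : ℕ) (v : V) : Prop where
  eq_of_adj_adj : ∀ w z, G.Adj v w → G.Adj w z → z ≠ v → y z = t
  not_adj : ∀ w z, G.Adj v w → G.Adj w z → ¬ G.Adj v z
  unique : ∀ w w' z, z ≠ v → G.Adj v w → G.Adj w z → G.Adj v w' → G.Adj w' z → w = w'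
  sum_degree : ∑ w ∈ G.neighborFinset v, G.degree w = m

/-- Evaluate `A² y = m y` at `v`. The closed walks contribute `degree v * y v`, and each vertex of
`D` contributes at least `y v`, so `D.card + degree v ≤ m`. The degree hypothesis gives the reverse
inequality, so every estimate is an equality. -/
theorem IsPerronVector.isTight_of_card_filter_adj {lam : ℝ} {y : V → ℝ}
    (hy : G.IsPerronVector lam y) {m : ℕ} (hm : lam ^ 2 = m) [DecidableRel (G.distPower 2).Adj]
    {U : Finset V} {v : V} (hv : ∀ x ∈ U, y v ≤ y x)
    (hdeg : m ≤ (U.filter ((G.distPower 2).Adj v)).card) :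
    G.IsTight y (y v) m v ∧ (U.filter ((G.distPower 2).Adj v)).card = m ∧
      (∀ w, G.Adj v w → w ∈ U) ∧ ∀ w z, G.Adj v w → G.Adj w z → z ≠ v → z ∈ U := by
  have ht := hy.pos v
  set N := U.filter (G.Adj v) with hN
  set D := U.filter fun z => z ≠ v ∧ ¬ G.Adj v z ∧ ∃ w, G.Adj v w ∧ G.Adj w z with hD
  have hsub : U.filter ((G.distPower 2).Adj v) ⊆ N ∪ D := by
    intro z
    simp only [hN, hD, Finset.mem_filter, Finset.mem_union, distPower_two_adj]
    grind
  have hND : (U.filter ((G.distPower 2).Adj v)).card ≤ N.card + D.card :=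
    (Finset.card_le_card hsub).trans (Finset.card_union_le _ _)
  have hNsub : N ⊆ G.neighborFinset v := fun w hw => by
    simpa using (Finset.mem_filter.1 hw).2
  have hNd : N.card ≤ G.degree v := by
    rw [← card_neighborFinset_eq_degree]
    exact Finset.card_le_card hNsub
  have hle : ∀ z ∈ Finset.univ.erase v,
      (if z ∈ D then y v else 0) ≤ (G.numTwoWalks v z : ℝ) * y z := by
    intro z _
    split_ifs with hz
    · obtain ⟨hzU, -, -, w, hvw, hwz⟩ := Finset.mem_filter.1 hz
      have : (1 : ℝ) ≤ G.numTwoWalks v z := by exact_mod_cast numTwoWalks_pos hvw hwz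
      nlinarith [hv z hzU]
    · exact mul_nonneg (Nat.cast_nonneg _) (hy.pos z).le
  have hsumD : ∑ z ∈ Finset.univ.erase v, (if z ∈ D then y v else 0) = D.card * y v := by
    rw [← Finset.sum_filter, Finset.sum_const, nsmul_eq_mul]
    congr 3
    ext z
    simp only [hD, Finset.mem_filter, Finset.mem_erase, Finset.mem_univ]
    tauto
  have hsum : ∑ z ∈ Finset.univ.erase v, (G.numTwoWalks v z : ℝ) * y z =
      ((m : ℝ) - G.degree v) * y v := by
    have := hy.sum_numTwoWalks_mul v
    rw [← Finset.add_sum_erase _ _ (Finset.mem_univ v), numTwoWalks_self, hm] at this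
    linarith
  have hDm : (D.card : ℝ) ≤ (m : ℝ) - G.degree v := by
    have := Finset.sum_le_sum hle
    rw [hsumD, hsum] at this
    exact le_of_mul_le_mul_right this ht
  have hDm' : D.card + G.degree v ≤ m := by
    have : (D.card : ℝ) + G.degree v ≤ m := by linarith
    exact_mod_cast this
  have hDeq : D.card + G.degree v = m := by omega
  have hpt : ∀ z ∈ Finset.univ.erase v,
      (if z ∈ D then y v else 0) = (G.numTwoWalks v z : ℝ) * y z := by
    refine (Finset.sum_eq_sum_iff_of_le hle).1 ?_
    rw [hsumD, hsum, ← hDeq]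
    push_cast
    ring
  have hNeq : N = G.neighborFinset v := by
    refine Finset.eq_of_subset_of_card_le hNsub ?_
    rw [card_neighborFinset_eq_degree]
    omega
  have hmemD : ∀ w z, G.Adj v w → G.Adj w z → z ≠ v → z ∈ D := fun w z hvw hwz hz => by
    by_contra hzD
    have h := hpt z (by simpa using hz)
    rw [if_neg hzD] at h
    have : (0 : ℝ) < G.numTwoWalks v z := by exact_mod_cast numTwoWalks_pos hvw hwz
    exact (mul_pos this (hy.pos z)).ne h
  have hDval : ∀ z ∈ D, G.numTwoWalks v z = 1 ∧ y z = y v := fun z hz => by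
    have hz' := Finset.mem_filter.1 hz
    obtain ⟨w, hvw, hwz⟩ := hz'.2.2.2
    have h := hpt z (by simpa using hz'.2.1)
    rw [if_pos hz] at h
    have h1 := numTwoWalks_pos hvw hwz
    have h1' : (1 : ℝ) ≤ G.numTwoWalks v z := by exact_mod_cast h1
    have h2 := hv z hz'.1
    have h3 : (G.numTwoWalks v z : ℝ) ≤ 1 := by nlinarith
    have h4 : G.numTwoWalks v z ≤ 1 := by exact_mod_cast h3
    have h5 : G.numTwoWalks v z = 1 := by omega
    refine ⟨h5, ?_⟩
    rw [h, h5, Nat.cast_one, one_mul]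
  refine ⟨⟨fun w z hvw hwz hz => (hDval z (hmemD w z hvw hwz hz)).2, fun w z hvw hwz hvz => ?_,
    fun w w' z hz hvw hwz hvw' hwz' => ?_, ?_⟩, by omega, fun w hvw => ?_,
    fun w z hvw hwz hz => (Finset.mem_filter.1 (hmemD w z hvw hwz hz)).1⟩
  · exact (Finset.mem_filter.1 (hmemD w z hvw hwz hvz.ne')).2.2.1 hvz
  · have h1 := (hDval z (hmemD w z hvw hwz hz)).1.le
    rw [numTwoWalks, Finset.card_le_one] at h1
    exact h1 w (by simp [hvw, hwz]) w' (by simp [hvw', hwz'])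
  · rw [sum_degree_neighborFinset, ← Finset.add_sum_erase _ _ (Finset.mem_univ v),
      numTwoWalks_self, ← hDeq, add_comm, Nat.add_right_cancel_iff, Finset.card_eq_sum_ones,
      ← Finset.sum_subset (s₁ := D)]
    · exact Finset.sum_congr rfl fun z hz => (hDval z hz).1
    · intro z hz
      simpa using (Finset.mem_filter.1 hz).2.1
    · intro z hz hzD
      have h := hpt z hz
      rw [if_neg hzD, eq_comm, mul_eq_zero, or_iff_left (hy.pos z).ne'] at h
      exact_mod_cast h
  · have : w ∈ N := by rw [hNeq]; simpa using hvw
    exact (Finset.mem_filter.1 this).1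

theorem IsPerronVector.exists_isTight {lam : ℝ} {y : V → ℝ} (hy : G.IsPerronVector lam y)
    (hconn : G.Connected) {m : ℕ} (hm : lam ^ 2 = m) [DecidableRel (G.distPower 2).Adj]
    (hcol : ¬ (G.distPower 2).Colorable m) :
    ∃ v₀, (∀ x, y v₀ ≤ y x) ∧ (∀ v, y v = y v₀ → G.IsTight y (y v₀) m v) ∧
      (∀ v, y v = y v₀ → (Finset.univ.filter ((G.distPower 2).Adj v)).card = m) ∧
      ∀ x, y x = y v₀ ∨ ∃ v, y v = y v₀ ∧ G.Adj v x := by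
  obtain ⟨U, hU, hdeg⟩ := exists_le_card_of_not_colorable hcol
  obtain ⟨v₀, hv₀, hmin⟩ := U.exists_min_image y hU
  have key : ∀ v ∈ U, y v = y v₀ → _ := fun v hv hvt =>
    hy.isTight_of_card_filter_adj hm (U := U) (v := v) (by rwa [hvt]) (hdeg v hv)
  -- Tightness carries minimality over to distance two, so minimizers in `U` and their neighbors
  -- exhaust the connected graph.
  have hall := hconn.forall_of_adj_closed
    (p := fun x => (x ∈ U ∧ y x = y v₀) ∨ ∃ v, (v ∈ U ∧ y v = y v₀) ∧ G.Adj v x) (v := v₀) (by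
      rintro x z (⟨hx, hxt⟩ | ⟨v, ⟨hv, hvt⟩, hvx⟩) hxz
      · exact Or.inr ⟨x, ⟨hx, hxt⟩, hxz⟩
      · left
        obtain rfl | hzv := eq_or_ne z v
        · exact ⟨hv, hvt⟩
        · obtain ⟨h1, -, -, h2⟩ := key v hv hvt
          exact ⟨h2 x z hvx hxz hzv, (h1.eq_of_adj_adj x z hvx hxz hzv).trans hvt⟩)
    (Or.inl ⟨hv₀, rfl⟩)
  have hUuniv : U = Finset.univ := by
    refine Finset.eq_univ_of_forall fun x => ?_
    rcases hall x with h | ⟨v, ⟨hv, hvt⟩, hvx⟩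
    · exact h.1
    · exact (key v hv hvt).2.2.1 x hvx
  subst hUuniv
  refine ⟨v₀, fun x => hmin x (Finset.mem_univ x), fun v hv => ?_,
    fun v hv => (key v (Finset.mem_univ v) hv).2.1, fun x => ?_⟩
  · have := (key v (Finset.mem_univ v) hv).1
    rwa [hv] at this
  · simpa using hall x

end Tight

/-! ### Brooks-type extension of a partial coloring -/

section Extension

variable {V : Type*} [Fintype V] [DecidableEq V] {H : SimpleGraph V} [DecidableRel H.Adj]

theorem card_filter_add_card_image_lt_of_adj {m : ℕ} {x z : V} {P R : Finset V} (c : V → ℕ)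
    (hx : (Finset.univ.filter (H.Adj x)).card ≤ m) (hPR : Disjoint P R) (hxz : H.Adj x z)
    (hzP : z ∉ P) (hzR : z ∉ R) :
    (R.filter (H.Adj x)).card + ((P.filter (H.Adj x)).image c).card < m := by
  have h1 : (R.filter (H.Adj x)).card + (P.filter (H.Adj x)).card ≤
      ((Finset.univ.filter (H.Adj x)).erase z).card := by
    rw [← Finset.card_union_of_disjoint (Finset.disjoint_filter_filter hPR.symm)]
    refine Finset.card_le_card fun w hw => ?_
    simp only [Finset.mem_union, Finset.mem_filter, Finset.mem_erase, Finset.mem_univ,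
      true_and] at hw ⊢
    refine ⟨?_, by tauto⟩
    rintro rfl
    tauto
  have hz : z ∈ Finset.univ.filter (H.Adj x) := by simpa using hxz
  rw [Finset.card_erase_of_mem hz] at h1
  have := Finset.card_pos.2 ⟨z, hz⟩
  have := Finset.card_image_le (s := P.filter (H.Adj x)) (f := c)
  omega

theorem card_filter_add_card_image_lt_of_eq {m : ℕ} {x a b : V} {P R : Finset V} {c : V → ℕ}
    (hx : (Finset.univ.filter (H.Adj x)).card ≤ m) (hPR : Disjoint P R) (ha : a ∈ P) (hb : b ∈ P)
    (hab : a ≠ b) (hc : c a = c b) (hxa : H.Adj x a) (hxb : H.Adj x b) :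
    (R.filter (H.Adj x)).card + ((P.filter (H.Adj x)).image c).card < m := by
  have h1 : (R.filter (H.Adj x)).card + (P.filter (H.Adj x)).card ≤
      (Finset.univ.filter (H.Adj x)).card := by
    rw [← Finset.card_union_of_disjoint (Finset.disjoint_filter_filter hPR.symm)]
    refine Finset.card_le_card fun w hw => ?_
    simp only [Finset.mem_union, Finset.mem_filter, Finset.mem_univ, true_and] at hw ⊢
    tauto
  have h2 : ((P.filter (H.Adj x)).image c).card ≠ (P.filter (H.Adj x)).card := fun h =>
    hab (Finset.card_image_iff.1 h (by simp [ha, hxa]) (by simp [hb, hxb]) hc)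
  have := Finset.card_image_le (s := P.filter (H.Adj x)) (f := c)
  omega

/-- Color `x` last: it sees one color twice, at `a` and `b`. Every other vertex can be colored while
one of its neighbors in `Q` is still uncolored. -/
theorem colorable_of_extension {m : ℕ} {P Q : Finset V} (hPQ : Disjoint P Q)
    (huniv : P ∪ Q = Finset.univ) {c : V → ℕ} (hc : ∀ x ∈ P, c x < m)
    (hproper : ∀ x ∈ P, ∀ z ∈ P, H.Adj x z → c x ≠ c z)
    (hdeg : ∀ x ∈ Q, (Finset.univ.filter (H.Adj x)).card ≤ m)
    (hQ : ∀ R ⊆ Q, R.Nonempty → R ≠ Q → ∃ x ∈ R, ∃ z ∈ Q, z ∉ R ∧ H.Adj x z)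
    {x a b : V} (hx : x ∈ Q) (ha : a ∈ P) (hb : b ∈ P) (hab : a ≠ b) (hcab : c a = c b)
    (hxa : H.Adj x a) (hxb : H.Adj x b) : H.Colorable m := by
  obtain ⟨c', -, h1, h2⟩ := exists_coloring_extension hc hproper Q hPQ fun R hR hne => by
    have hPR : Disjoint P R := hPQ.mono_right hR
    obtain rfl | hRQ := eq_or_ne R Q
    · exact ⟨x, hx, card_filter_add_card_image_lt_of_eq (hdeg x hx) hPR ha hb hab hcab hxa hxb⟩
    · obtain ⟨x, hxR, z, hzQ, hzR, hxz⟩ := hQ R hR hne hRQ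
      exact ⟨x, hxR, card_filter_add_card_image_lt_of_adj c (hdeg x (hR hxR)) hPR hxz
        (fun h => Finset.disjoint_left.1 hPQ h hzQ) hzR⟩
  rw [huniv] at h1 h2
  exact colorable_of_coloring_nat (by simpa using h1) (by simpa using h2)

end Extension

/-! ### The regular case: Moore graphs -/

section Regular

variable {V : Type*} [Fintype V] [DecidableEq V] {G : SimpleGraph V} [DecidableRel G.Adj]

theorem Connected.exists_adj_dist_eq (hconn : G.Connected) {x z : V} {n : ℕ}
    (h : G.dist x z = n + 1) : ∃ w, G.Adj x w ∧ G.dist w z = n := by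
  obtain ⟨w, hxw, hw⟩ := hconn.exists_adj_dist_le h.le (by rintro rfl; simp at h)
  have := hconn.dist_triangle (u := x) (v := w) (w := z)
  rw [dist_eq_one_iff_adj.2 hxw] at this
  exact ⟨w, hxw, by omega⟩

omit [Fintype V] [DecidableEq V] [DecidableRel G.Adj] in
theorem egirth_eq_five {v w₁ w₂ z q : V} (hnot : ∀ v w z, G.Adj v w → G.Adj w z → ¬ G.Adj v z)
    (huniq : ∀ v w w' z, z ≠ v → G.Adj v w → G.Adj w z → G.Adj v w' → G.Adj w' z → w = w')
    (h1 : G.Adj v w₁) (h2 : G.Adj w₁ z) (h3 : G.Adj z q) (h4 : G.Adj q w₂) (h5 : G.Adj w₂ v)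
    (hw : w₁ ≠ w₂) (hz : z ≠ v) : G.egirth = 5 := by
  refine le_antisymm ?_ (le_egirth.2 fun a p hp => ?_)
  · have hzw : z ≠ w₂ := by rintro rfl; exact hnot _ _ _ h1 h2 h5.symm
    have hqv : q ≠ v := by rintro rfl; exact hnot _ _ _ h1 h2 h3.symm
    have hqw : q ≠ w₁ := by rintro rfl; exact hnot _ _ _ h1 h4 h5.symm
    have hcyc : (Walk.cons h1 (.cons h2 (.cons h3 (.cons h4 (.cons h5 .nil))))).IsCycle := by
      have := h1.ne; have := h2.ne; have := h3.ne; have := h4.ne; have := h5.ne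
      simp [Walk.cons_isCycle_iff, Walk.cons_isPath_iff]
      grind
    simpa using egirth_le_length hcyc
  · have h3 := hp.three_le_length
    suffices 5 ≤ p.length by exact_mod_cast this
    by_contra! hlt
    match p, hp, h3, hlt with
    | .cons h1 (.cons h2 (.cons h3 .nil)), _, _, _ => exact hnot _ _ _ h1 h2 h3.symm
    | .cons h1 (.cons h2 (.cons h3 (.cons h4 .nil))), hp, _, _ =>
      have hnd := hp.support_nodup
      simp at hnd
      have := huniq _ _ _ _ (by grind) h1 h2 h4.symm h3.symm
      grind

theorem Connected.isMooreGraph_of_not_colorable (hconn : G.Connected)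
    (hcard : 3 ≤ Fintype.card V) [DecidableRel (G.distPower 2).Adj] {d : ℕ}
    (hd : G.IsRegularOfDegree d) (hnot : ∀ v w z, G.Adj v w → G.Adj w z → ¬ G.Adj v z)
    (huniq : ∀ v w w' z, z ≠ v → G.Adj v w → G.Adj w z → G.Adj v w' → G.Adj w' z → w = w')
    (hdeg : ∀ v, (Finset.univ.filter ((G.distPower 2).Adj v)).card = d * d)
    (hcol : ¬ (G.distPower 2).Colorable (d * d)) : G.IsMooreGraph d 2 := by
  obtain ⟨v, w₁, w₂, hw, hv1, hv2⟩ := hconn.exists_two_neighbors hcard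
  have hd2 : 2 ≤ d := by
    rw [← hd v, ← card_neighborFinset_eq_degree, ← Finset.card_pair hw]
    refine Finset.card_le_card fun x => ?_
    simp only [Finset.mem_insert, Finset.mem_singleton, mem_neighborFinset]
    rintro (rfl | rfl) <;> assumption
  by_cases hdiam : ∀ x z, G.dist x z ≤ 2
  · have hadj : ∀ x z, x ≠ z → G.Adj x z ∨ ∃ w, G.Adj x w ∧ G.Adj w z := fun x z h =>
      (distPower_two_adj.1 (hconn.distPower_adj.2 ⟨h, hdiam x z⟩)).2
    have hcard' : Fintype.card V = d * d + 1 := by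
      rw [← hdeg v, ← Finset.card_univ, ← Finset.card_erase_add_one (Finset.mem_univ v)]
      congr 2
      ext z
      simp only [Finset.mem_erase, Finset.mem_univ, and_true, Finset.mem_filter, true_and,
        hconn.distPower_adj]
      exact ⟨fun h => ⟨h.symm, hdiam v z⟩, fun h => h.1.symm⟩
    refine ⟨hconn, hd, ?_, le_antisymm ?_ ?_, ?_⟩
    · rw [hcard']
      obtain ⟨e, rfl⟩ := Nat.exists_eq_add_of_le' (show 1 ≤ d by omega)
      simp only [Finset.sum_range_succ, Finset.range_zero, Finset.sum_empty, pow_zero, pow_one,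
        Nat.add_sub_cancel]
      ring
    · refine ediam_le_of_edist_le fun x z => ?_
      rw [← (hconn.preconnected x z).coe_dist_eq_edist]
      exact_mod_cast hdiam x z
    · have h2 : G.edist w₁ w₂ = 2 := edist_eq_two_iff.2
        ⟨hw, hnot _ _ _ hv1.symm hv2, v, hv1.symm, hv2.symm⟩
      exact (le_of_eq (by rw [h2]; rfl)).trans edist_le_ediam
    -- Diameter two closes the path `w₂, v, w₁, z` to a pentagon, since `z` and `w₂` are not
    -- adjacent.
    · have : ∃ z ∈ G.neighborFinset w₁, z ≠ v := by
        refine Finset.exists_mem_ne ?_ v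
        rw [card_neighborFinset_eq_degree, hd]
        omega
      obtain ⟨z, hz, hzv⟩ := this
      rw [mem_neighborFinset] at hz
      have hzw : z ≠ w₂ := by rintro rfl; exact hnot _ _ _ hv1 hz hv2
      obtain h | ⟨q, hzq, hqw⟩ := hadj z w₂ hzw
      · exact absurd (huniq v w₁ w₂ z hzv hv1 hz hv2 h.symm) hw
      · rw [egirth_eq_five hnot huniq hv1 hz hzq hqw hv2.symm hw hzv]
        norm_num
  · exfalso
    push Not at hdiam
    obtain ⟨a, z, haz⟩ := hdiam
    obtain ⟨n, hn⟩ := Nat.exists_eq_add_of_le' (show 3 ≤ G.dist a z from haz)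
    obtain ⟨p, hap, hp⟩ := hconn.exists_adj_dist_eq hn
    obtain ⟨q, hpq, hq⟩ := hconn.exists_adj_dist_eq hp
    obtain ⟨b, hqb, hb⟩ := hconn.exists_adj_dist_eq hq
    have hab : 3 ≤ G.dist a b := by
      have := hconn.dist_triangle (u := a) (v := b) (w := z)
      omega
    have hpb : p ≠ b := by
      rintro rfl
      rw [dist_eq_one_iff_adj.2 hap] at hab
      omega
    have hne : a ≠ b := by
      rintro rfl
      simp at hab
    have hHab : ¬ (G.distPower 2).Adj a b := fun h => by
      have := (hconn.distPower_adj.1 h).2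
      omega
    have hGab : ¬ G.Adj a b := fun h => by
      rw [dist_eq_one_iff_adj.2 h] at hab
      omega
    -- On a geodesic `a, p, q, b` the ends may share a color, and `p` is within distance two of
    -- both.
    refine hcol (colorable_of_extension (P := {a, b}) (Q := Finset.univ \ {a, b})
      (c := fun _ => 0) Finset.disjoint_sdiff (by simp) (fun _ _ => by positivity) ?_
      (fun x _ => (hdeg x).le) ?_ (x := p) (a := a) (b := b) ?_ (by simp) (by simp) hne rfl
      (distPower_two_adj.2 ⟨hap.ne', Or.inl hap.symm⟩)
      (distPower_two_adj.2 ⟨hpb, Or.inr ⟨q, hpq, hqb⟩⟩))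
    · intro x hx z hz hxz
      simp only [Finset.mem_insert, Finset.mem_singleton] at hx hz
      rcases hx with rfl | rfl <;> rcases hz with rfl | rfl
      · exact absurd rfl hxz.ne
      · exact absurd hxz hHab
      · exact absurd hxz.symm hHab
      · exact absurd rfl hxz.ne
    · intro R hR hRne hRQ
      by_contra! hno
      obtain ⟨x₀, hx₀⟩ := hRne
      obtain ⟨z₀, hz₀, hz₀R⟩ := Finset.exists_of_ssubset (hR.ssubset_of_ne hRQ)
      -- Deleting `a` and `b` keeps the square connected: for a closest separated pair, the next two
      -- vertices on a geodesic would both be in `{a, b}`, yet they are adjacent and `a`, `b` are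
      -- not.
      have hclaim : ∀ n, ∀ x ∈ R, ∀ z ∈ Finset.univ \ {a, b}, z ∉ R → G.dist x z = n → False := by
        intro n
        induction n using Nat.strong_induction_on with
        | _ n ih =>
          intro x hx z hz hzR hdist
          have hxz : x ≠ z := by rintro rfl; exact hzR hx
          have h3 : 3 ≤ n := by
            by_contra! hlt
            exact hno x hx z hz hzR (hconn.distPower_adj.2 ⟨hxz, by omega⟩)
          obtain ⟨k, rfl⟩ := Nat.exists_eq_add_of_le' h3
          obtain ⟨p', hxp, hp'⟩ := hconn.exists_adj_dist_eq hdist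
          obtain ⟨q', hpq', hq'⟩ := hconn.exists_adj_dist_eq hp'
          have hxq : x ≠ q' := by rintro rfl; omega
          have hmem : ∀ w, x ≠ w → G.dist w z < k + 3 → (G.distPower 2).Adj x w →
              w = a ∨ w = b := by
            intro w hxw hwz hadj
            by_contra hw
            have hwQ : w ∈ Finset.univ \ {a, b} := by simpa using hw
            by_cases hwR : w ∈ R
            · exact ih _ hwz w hwR z hz hzR rfl
            · exact hno x hx w hwQ hwR hadj
          have e1 := hmem p' hxp.ne (by omega) (distPower_two_adj.2 ⟨hxp.ne, Or.inl hxp⟩)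
          have e2 := hmem q' hxq (by omega) (distPower_two_adj.2 ⟨hxq, Or.inr ⟨p', hxp, hpq'⟩⟩)
          rcases e1 with rfl | rfl <;> rcases e2 with rfl | rfl
          · exact hpq'.ne rfl
          · exact hGab hpq'
          · exact hGab hpq'.symm
          · exact hpq'.ne rfl
      exact hclaim _ x₀ hx₀ z₀ hz₀ hz₀R rfl
    · simp [hap.ne', hpb]

end Regular

/-! ### The bipartite case: stars -/

section Bipartite

variable {V : Type*} [Fintype V] [DecidableEq V] {G : SimpleGraph V} [DecidableRel G.Adj]

omit [Fintype V] [DecidableRel G.Adj] in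
theorem Connected.isStar_of_leaf_neighbor (hconn : G.Connected) {u w : V} (huw : G.Adj u w)
    (hu : ∀ x, G.Adj u x → x = w) (hw : ∀ v x, G.Adj w v → v ≠ u → G.Adj v x → x = w) :
    G.IsStar := by
  have hall := hconn.forall_of_adj_closed (p := fun x => x = w ∨ G.Adj w x) (v := w) (by
    rintro x z (rfl | hwx) hxz
    · exact Or.inr hxz
    · left
      obtain rfl | hxu := eq_or_ne x u
      · exact hu z hxz
      · exact hw x z hwx hxu hxz) (Or.inl rfl)
  refine ⟨w, ?_⟩
  ext x z
  rw [starGraph_adj]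
  refine ⟨fun h => ⟨h.ne, ?_⟩, ?_⟩
  · by_contra! hxz
    have hwx := (hall x).resolve_left hxz.1
    obtain rfl | hxu := eq_or_ne x u
    · exact hxz.2 (hu z h)
    · exact hxz.2 (hw x z hwx hxu h)
  · rintro ⟨hne, rfl | rfl⟩
    · exact (hall z).resolve_left hne.symm
    · exact ((hall x).resolve_left hne).symm

/-- A bipartite graph with sides `C` and its complement whose square needs more than `m` colors is
a star, provided the vertices of `C` are tight and the other side can be colored greedily. -/
theorem Connected.isStar_of_not_colorable (hconn : G.Connected) [DecidableRel (G.distPower 2).Adj]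
    {m : ℕ} {C : Finset V} (hC : C.Nonempty) (hCC : ∀ v ∈ C, ∀ w, G.Adj v w → w ∉ C)
    (hWC : ∀ w ∉ C, ∀ v, G.Adj w v → v ∈ C)
    (huniq : ∀ v ∈ C, ∀ w w' z, z ≠ v → G.Adj v w → G.Adj w z → G.Adj v w' → G.Adj w' z → w = w')
    (hsum : ∀ v ∈ C, ∑ w ∈ G.neighborFinset v, G.degree w = m)
    (hdeg : ∀ v ∈ C, (Finset.univ.filter ((G.distPower 2).Adj v)).card = m)
    (hW2 : ∀ w ∉ C, 2 ≤ G.degree w)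
    (hW : ∀ R ⊆ Cᶜ, R.Nonempty → ∃ x ∈ R, (R.filter ((G.distPower 2).Adj x)).card + 2 ≤ m)
    (hm : 0 < m) (hcol : ¬ (G.distPower 2).Colorable m) : G.IsStar := by
  obtain ⟨c₀, hc₀⟩ := hC
  obtain ⟨u, huC, hu⟩ := C.exists_max_image (G.dist c₀) ⟨c₀, hc₀⟩
  by_cases hex : ∃ w v w', G.Adj u w ∧ G.Adj w v ∧ v ≠ u ∧ G.Adj v w' ∧ w' ≠ w
  · exfalso
    obtain ⟨w, v, w', huw, hwv, hvu, hvw', hw'⟩ := hex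
    have hvC := hWC w (hCC u huC w huw) v hwv
    have hw'C := hCC v hvC w' hvw'
    have huw' : u ≠ w' := by rintro rfl; exact hw'C huC
    have hHuw' : ¬ (G.distPower 2).Adj u w' := by
      rw [distPower_two_adj]
      rintro ⟨-, h | ⟨s, hus, hsw⟩⟩
      · exact hw' (huniq u huC w' w v hvu h hvw'.symm huw hwv)
      · exact hw'C (hWC s (hCC u huC s hus) w' hsw)
    have hcu : c₀ ≠ u := by
      rintro rfl
      have := hu v hvC
      rw [dist_self, Nat.le_zero, hconn.dist_eq_zero_iff] at this
      exact hvu this.symm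
    -- The side `Cᶜ` needs only `m - 1` colors, so the last color is free for `u` and `w'`, both of
    -- which are square-neighbors of `v`.
    obtain ⟨c, hc1, hc2⟩ := exists_coloring_of_degenerate (H := G.distPower 2) (m := m - 1) Cᶜ
      fun R hR hne => by
        obtain ⟨x, hx, h⟩ := hW R hR hne
        exact ⟨x, hx, by omega⟩
    have huCc : u ∉ Cᶜ := by simpa using huC
    refine hcol (colorable_of_extension (P := insert u Cᶜ) (Q := C.erase u)
      (c := fun x => if x = u ∨ x = w' then m - 1 else c x) ?_ ?_ ?_ ?_
      (fun x hx => (hdeg x (Finset.mem_of_mem_erase hx)).le) ?_ (x := v) (a := u) (b := w')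
      (by simp [hvu, hvC]) (by simp) (by simp [hw'C]) huw' (by simp)
      (distPower_two_adj.2 ⟨hvu, Or.inr ⟨w, hwv.symm, huw.symm⟩⟩)
      (distPower_two_adj.2 ⟨hvw'.ne, Or.inl hvw'⟩))
    · rw [Finset.disjoint_left]
      intro x
      simp only [Finset.mem_insert, Finset.mem_compl, Finset.mem_erase]
      tauto
    · ext x
      simp only [Finset.mem_union, Finset.mem_insert, Finset.mem_compl, Finset.mem_erase,
        Finset.mem_univ, iff_true]
      tauto
    · intro x hx
      split_ifs with h
      · omega
      · have := hc1 x ((Finset.mem_insert.1 hx).resolve_left fun h' => h (Or.inl h'))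
        omega
    · intro x hx z hz hxz
      split_ifs with h1 h2 h2
      · exfalso
        rcases h1 with rfl | rfl <;> rcases h2 with rfl | rfl
        · exact hxz.ne rfl
        · exact hHuw' hxz
        · exact hHuw' hxz.symm
        · exact hxz.ne rfl
      · exact (hc1 z ((Finset.mem_insert.1 hz).resolve_left fun h' => h2 (Or.inl h'))).ne'
      · exact (hc1 x ((Finset.mem_insert.1 hx).resolve_left fun h' => h1 (Or.inl h'))).ne
      · exact hc2 x ((Finset.mem_insert.1 hx).resolve_left fun h' => h1 (Or.inl h')) z
          ((Finset.mem_insert.1 hz).resolve_left fun h' => h2 (Or.inl h')) hxz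
    · intro R hR hRne hRQ
      by_contra! hno
      -- Since `u` is farthest from `c₀`, two steps along a geodesic towards `c₀` never land on `u`,
      -- so `C.erase u` stays connected in the square.
      have hclaim : ∀ n, ∀ z ∈ C.erase u, G.dist z c₀ = n → (z ∈ R ↔ c₀ ∈ R) := by
        intro n
        induction n using Nat.strong_induction_on with
        | _ n ih =>
          intro z hz hdist
          have hzC := Finset.mem_of_mem_erase hz
          obtain rfl | hzc := eq_or_ne z c₀
          · rfl
          obtain ⟨k, rfl⟩ := Nat.exists_eq_add_of_le' (show 1 ≤ n by
            rw [← hdist]; exact hconn.pos_dist_of_ne hzc)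
          obtain ⟨p, hzp, hp⟩ := hconn.exists_adj_dist_eq hdist
          have hpC := hCC z hzC p hzp
          have hpc : p ≠ c₀ := by rintro rfl; exact hpC hc₀
          obtain ⟨k, rfl⟩ := Nat.exists_eq_add_of_le' (show 1 ≤ k by
            rw [← hp]; exact hconn.pos_dist_of_ne hpc)
          obtain ⟨q, hpq, hq⟩ := hconn.exists_adj_dist_eq hp
          have hqu : q ≠ u := by
            rintro rfl
            have := hu z hzC
            rw [G.dist_comm, hdist, G.dist_comm, hq] at this
            omega
          have hqQ : q ∈ C.erase u := Finset.mem_erase.2 ⟨hqu, hWC p hpC q hpq⟩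
          have hzq : (G.distPower 2).Adj z q :=
            distPower_two_adj.2 ⟨by rintro rfl; omega, Or.inr ⟨p, hzp, hpq⟩⟩
          rw [← ih k (by omega) q hqQ hq]
          constructor
          · intro hzR
            by_contra hqR
            exact hno z hzR q hqQ hqR hzq
          · intro hqR
            by_contra hzR
            exact hno q hqR z hz hzR hzq.symm
      obtain ⟨x₀, hx₀⟩ := hRne
      have hc₀R := (hclaim _ x₀ (hR hx₀) rfl).1 hx₀
      exact hRQ (hR.antisymm fun z hz => (hclaim _ z hz rfl).2 hc₀R)
  · push Not at hex
    -- Now every `v ≠ u` adjacent to such a `w` is a leaf, so the degree sum at `v` is just `degree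
    -- w`. The degree sum at `u` then makes `u` a leaf too.
    have hdegw : ∀ w ∈ G.neighborFinset u, G.degree w = m := fun w huw => by
      rw [mem_neighborFinset] at huw
      have : ∃ v ∈ G.neighborFinset w, v ≠ u := by
        refine Finset.exists_mem_ne ?_ u
        rw [card_neighborFinset_eq_degree]
        have := hW2 w (hCC u huC w huw)
        omega
      obtain ⟨v, hwv, hvu⟩ := this
      rw [mem_neighborFinset] at hwv
      have hN : G.neighborFinset v = {w} := by
        ext x
        rw [mem_neighborFinset, Finset.mem_singleton]
        exact ⟨fun h => hex w v x huw hwv hvu h, fun h => h ▸ hwv.symm⟩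
      have := hsum v (hWC w (hCC u huC w huw) v hwv)
      rwa [hN, Finset.sum_singleton] at this
    have h1 := hsum u huC
    rw [Finset.sum_congr rfl hdegw, Finset.sum_const, smul_eq_mul] at h1
    have h2 : (G.neighborFinset u).card = 1 := Nat.eq_of_mul_eq_mul_right hm (by omega)
    obtain ⟨w, hw⟩ := Finset.card_eq_one.1 h2
    have hN : ∀ x, G.Adj u x ↔ x = w := fun x => by
      rw [← mem_neighborFinset, hw, Finset.mem_singleton]
    exact hconn.isStar_of_leaf_neighbor ((hN w).2 rfl) (fun x => (hN x).1)
      fun v x hwv hvu hvx => hex w v x ((hN w).2 rfl) hwv hvu hvx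

end Bipartite

/-! ### Classification of the equality cases -/

section Equality

variable {V : Type*} [Fintype V] [DecidableEq V] {G : SimpleGraph V} [DecidableRel G.Adj]

/-- In `A² y = m y` at `x`, closed walks contribute `degree x * y x`, and each square-neighbor in
`R`, reached by a walk of length two, contributes at least `y x`. -/
theorem IsPerronVector.card_filter_add_degree_le {lam : ℝ} {y : V → ℝ}
    (hy : G.IsPerronVector lam y) {m : ℕ} (hm : lam ^ 2 = m) [DecidableRel (G.distPower 2).Adj]
    {R : Finset V} {x : V} (hx : ∀ z ∈ R, y x ≤ y z) (hR : ∀ z ∈ R, ¬ G.Adj x z) :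
    (R.filter ((G.distPower 2).Adj x)).card + G.degree x ≤ m := by
  have h := hy.sum_numTwoWalks_mul x
  rw [← Finset.add_sum_erase _ _ (Finset.mem_univ x), numTwoWalks_self, hm] at h
  have hsub : R.filter ((G.distPower 2).Adj x) ⊆ Finset.univ.erase x := fun z hz => by
    simpa using (Finset.mem_filter.1 hz).2.ne'
  have h1 : ((R.filter ((G.distPower 2).Adj x)).card : ℝ) * y x ≤
      ∑ z ∈ Finset.univ.erase x, (G.numTwoWalks x z : ℝ) * y z := by
    rw [← nsmul_eq_mul]
    refine (Finset.card_nsmul_le_sum _ (fun z => (G.numTwoWalks x z : ℝ) * y z) _ ?_).trans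
      (Finset.sum_le_sum_of_subset_of_nonneg hsub fun z _ _ =>
        mul_nonneg (Nat.cast_nonneg _) (hy.pos z).le)
    intro z hz
    rw [Finset.mem_filter, distPower_two_adj] at hz
    obtain ⟨w, hxw, hwz⟩ := hz.2.2.resolve_left (hR z hz.1)
    have : (1 : ℝ) ≤ G.numTwoWalks x z := by exact_mod_cast numTwoWalks_pos hxw hwz
    exact (hx z hz.1).trans (le_mul_of_one_le_left (hy.pos z).le this)
  have h2 : ((R.filter ((G.distPower 2).Adj x)).card : ℝ) + G.degree x ≤ m := by
    refine le_of_mul_le_mul_right ?_ (hy.pos x)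
    linarith
  exact_mod_cast h2

theorem Connected.isStar_or_isMooreGraph (hconn : G.Connected) (hcard : 3 ≤ Fintype.card V)
    (heq : (G.distChromaticNumber 2 : ℝ) = G.lambdaOne ^ 2 + 1) :
    G.IsStar ∨ ∃ d, G.IsMooreGraph d 2 := by
  classical
  have := hconn.nonempty
  obtain ⟨y, hy⟩ := hconn.exists_isPerronVector
  obtain ⟨m, hχ⟩ := Nat.exists_eq_add_of_le' (G.distChromaticNumber_pos 2)
  have hm : G.lambdaOne ^ 2 = m := by
    rw [hχ] at heq
    push_cast at heq
    linarith
  have hcol : ¬ (G.distPower 2).Colorable m := by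
    rw [← distChromaticNumber_le_iff]
    omega
  have hlam := hy.one_lt hconn hcard
  have hmpos : 0 < m := by
    have : (0 : ℝ) < m := by rw [← hm]; positivity
    exact_mod_cast this
  obtain ⟨v₀, hmin, htight, hdeg, hcover⟩ := hy.exists_isTight hconn hm hcol
  by_cases hedge : ∃ v w, y v = y v₀ ∧ y w = y v₀ ∧ G.Adj v w
  · right
    obtain ⟨v, w, hv, hw, hvw⟩ := hedge
    have hnbr : ∀ v w, y v = y v₀ → y w = y v₀ → G.Adj v w → ∀ z, G.Adj w z → y z = y v₀ :=
      fun v w hv hw hvw z hwz => by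
        obtain rfl | hzv := eq_or_ne z v
        · exact hv
        · exact (htight v hv).eq_of_adj_adj w z hvw hwz hzv
    have hall := hconn.forall_of_adj_closed
      (p := fun x => y x = y v₀ ∧ ∀ z, G.Adj x z → y z = y v₀) (v := w)
      (fun x z hx hxz => ⟨hx.2 z hxz, hnbr x z hx.1 (hx.2 z hxz) hxz⟩) ⟨hw, hnbr v w hv hw hvw⟩
    have hlamd : ∀ x, G.lambdaOne = G.degree x := fun x => by
      have h := hy.sum_eq x
      rw [Finset.sum_congr rfl fun z _ => (hall z).1, Finset.sum_const, nsmul_eq_mul,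
        card_neighborFinset_eq_degree, (hall x).1] at h
      exact (mul_right_cancel₀ (hy.pos v₀).ne' h).symm
    have hreg : G.IsRegularOfDegree (G.degree v₀) := fun x => by
      have := (hlamd x).symm.trans (hlamd v₀)
      exact_mod_cast this
    have hmd : m = G.degree v₀ * G.degree v₀ := by
      rw [hlamd v₀, sq] at hm
      exact_mod_cast hm.symm
    refine ⟨_, hconn.isMooreGraph_of_not_colorable hcard hreg
      (fun v => (htight v (hall v).1).not_adj)
      (fun v => (htight v (hall v).1).unique) (fun v => ?_) ?_⟩
    · rw [hdeg v (hall v).1, hmd]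
    · rwa [← hmd]
  · left
    push Not at hedge
    have hlow : ∀ x z, y x ≠ y v₀ → G.Adj x z → y z = y v₀ := fun x z hx hxz => by
      obtain ⟨v, hv, hvx⟩ := (hcover x).resolve_left hx
      obtain rfl | hzv := eq_or_ne z v
      · exact hv
      · exact (htight v hv).eq_of_adj_adj x z hvx hxz hzv
    -- All neighbors of `x` are minimizers, so degree at most one would give `lam * y x ≤ y v₀ < y
    -- x`, against `lam > 1`.
    have hdeg2 : ∀ x, y x ≠ y v₀ → 2 ≤ G.degree x := fun x hx => by
      by_contra! hlt
      have h := hy.sum_eq x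
      rw [Finset.sum_congr rfl fun z hz => hlow x z hx (by simpa using hz), Finset.sum_const,
        nsmul_eq_mul, card_neighborFinset_eq_degree] at h
      have h1 : (G.degree x : ℝ) ≤ 1 := by exact_mod_cast Nat.lt_succ_iff.1 hlt
      have h2 := (hmin x).lt_of_ne' hx
      have := hy.pos v₀
      nlinarith
    refine hconn.isStar_of_not_colorable (m := m)
      (C := Finset.univ.filter fun x => y x = y v₀) ⟨v₀, by simp⟩ ?_ ?_ ?_ ?_ ?_ ?_ ?_ hmpos hcol
    all_goals try simp only [Finset.mem_filter, Finset.mem_univ, true_and]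
    · exact fun v hv w hvw hw => hedge v w hv hw hvw
    · exact fun w hw v => hlow w v hw
    · exact fun v hv => (htight v hv).unique
    · exact fun v hv => (htight v hv).sum_degree
    · exact fun v hv => hdeg v hv
    · exact hdeg2
    · intro R hR hne
      obtain ⟨x, hxR, hx⟩ := R.exists_min_image y hne
      have hRy : ∀ z ∈ R, y z ≠ y v₀ := fun z hz => by simpa using hR hz
      have h1 := hy.card_filter_add_degree_le hm hx fun z hz hxz =>
        hRy z hz (hlow x z (hRy x hxR) hxz)
      have h2 := hdeg2 x (hRy x hxR)
      exact ⟨x, hxR, by omega⟩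

end Equality

end SimpleGraph

theorem mainTheorem8 {V : Type*} [Fintype V] [DecidableEq V] (G : SimpleGraph V)
    [DecidableRel G.Adj] (hconn : G.Connected) (hcard : 3 ≤ Fintype.card V) :
    (G.distChromaticNumber 2 : ℝ) ≤ G.lambdaOne ^ 2 + 1 ∧
    ((G.distChromaticNumber 2 : ℝ) = G.lambdaOne ^ 2 + 1 ↔
      G.IsStar ∨ ((∃ d : ℕ, G.IsMooreGraph d 2) ∧ G.ediam = 2 ∧ G.egirth = 5)) ∧
    (∀ γ : ℕ, 3 ≤ γ → (G.distChromaticNumber γ : ℝ) < G.lambdaOne ^ γ + 1) := by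
  refine ⟨hconn.distChromaticNumber_le hcard 2, ⟨fun h => ?_, ?_⟩,
    fun γ hγ => hconn.distChromaticNumber_lt hcard hγ⟩
  · refine (hconn.isStar_or_isMooreGraph hcard h).imp_right fun ⟨d, hd⟩ => ⟨⟨d, hd⟩, ?_, ?_⟩
    · exact hd.ediam_eq
    · rw [hd.egirth_eq]
      norm_num
  · rintro (h | ⟨⟨d, hd⟩, -, -⟩)
    · exact h.distChromaticNumber_eq hconn hcard
    · exact hd.distChromaticNumber_eq
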